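/- **Setting.** For an integer $m\ge 0$, a system of $m$ qubits has Hilbert space $(\mathbb C^2)^{\otimes m}$, and $|S|$ denotes the number of qubits of a system $S$. Let $\|\cdot\|$ be the operator norm and $\|A\|_1=\mathrm{Tr}\sqrt{A^\dagger A}$ the trace norm. A *gate* is an arbitrary unitary acting on at most two qubits, and the size of a circuit is its number of gates. A unitary $U$ on a system $S$ has *complexity* at most $s$ if, for some number of ancilla qubits (possibly none), a circuit of size at most $s$ on $S$ and the ancillas maps $\psi\otimes|0\cdots0\rangle$ to $U\psi\otimes|0\cdots 0\rangle$ for all $\psi$. Fix $\alpha>0$ and a family of unit vectors $|\Psi\rangle_{EHB}=\sum_{ijk}\Psi_{ijk}|i\rangle_E|j\rangle_H|k\rangle_B$ (states of black holes together with their radiation), where $E$ (early radiation) and $H$ (remaining black hole) are systems of qubits whose sizes may vary over the family and $B$ (late radiation) is a single qubit. Statements about $\mathrm{poly}(|H|)$ are asymptotic: "for every polynomial $p$ there is $h_0$ such that for all members of the family with $|H|\ge h_0$ the claim holds with $\mathrm{poly}(|H|)$ replaced by 'at most $p(|H|)$'". *Decoupling bound.* For all systems $O$ (observer) and $P$ (probe)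 of any numbers of qubits, and all circuits $U$ on $OPE$ of size $\mathrm{poly}(|H|)$, the reduced density operators $\rho_{OB},\rho_O,\rho_B$ of the state $U(|0\cdots0\rangle_O\otimes|0\cdots0\rangle_P\otimes|\Psi\rangle_{EHB})$ satisfy $$\|\rho_{OB}-\rho_O\otimes\rho_B\|_1\le 6\cdot 2^{-(\alpha|H|-|O|)} .$$ (A low-complexity initial state of the observer is prepared by the first part of $U$.) *Black hole code embedding.* Let $\tilde B$ be a single qubit (the interior mode) and $V_\Psi=\sqrt2\sum_{ijk}\Psi_{ijk}|i\rangle_E|j\rangle_H\langle k|_{\tilde B}$. A black hole code embedding is an isometry $V:\mathcal H_{\tilde B}\to\mathcal H_{EH}$, $V^\dagger V=I$, with $\|V-V_\Psi\|\le 2\cdot2^{-\alpha|H|}$. **Theorem.** Suppose that the decoupling bound holds. Then for all polynomials $p,q$ there is $h_0$ such that the following holds for every member of the family with $|H|\ge h_0$. Let $V$ be a black hole code embedding and let $U_1,\dots,U_N$ be arbitrary unitaries on $E$, where $N\le p(|H|)$ and each $U_a$ has complexity at most $q(|H|)$. Then there is a complete set of logical operators for the code, that is, an operator $T$ on $\mathcal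 H_{EH}$ for each normal operator $\tilde T$ on $\mathcal H_{\tilde B}$, such that for every such $T$ and every $a\in\{1,\dots,N\}$ $$\|[U_a,T]V\|\le 2\delta'\|\tilde T\|\qquad\text{and}\qquad \|TV-V\tilde T\|\le\delta'\|\tilde T\|,$$ where $U_a$ stands for $U_a\otimes I_H$ and $$\delta'=8\cdot 6^{1/4}\;2^{-\alpha|H|/4}\,(N+1)^{3/4}.$$ (The second inequality is asserted also for $N=0$.) -/

import Mathlib

open scoped Matrix Kronecker MatrixOrder Matrix.Norms.L2Operator

namespace BlackHole

/-- Computational basis labels of the system of qubits indexed by `Q`. -/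
abbrev Bits (Q : Type) : Type := Q → Fin 2

/-- The matrix on the qubits `Q` that acts as `G` on the qubits in `S` and as the identity on
all the other qubits. -/
def onQubits {Q : Type} [Fintype Q] [DecidableEq Q] (S : Finset Q)
    (G : Matrix (Bits S) (Bits S) ℂ) : Matrix (Bits Q) (Bits Q) ℂ :=
  fun x y =>
    if ∀ k, k ∉ S → x k = y k then G (fun k : S => x k) (fun k : S => y k) else 0

/-- An elementary gate: an arbitrary unitary acting on at most two of the qubits. -/
def IsGate {Q : Type} [Fintype Q] [DecidableEq Q] (M : Matrix (Bits Q) (Bits Q) ℂ) : Prop :=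
  ∃ S : Finset Q, S.card ≤ 2 ∧ ∃ G ∈ Matrix.unitaryGroup (Bits S) ℂ, M = onQubits S G

/-- `M` is a product of at most `s` elementary gates on the qubits `Q`. -/
def HasCircuit {Q : Type} [Fintype Q] [DecidableEq Q] (s : ℕ)
    (M : Matrix (Bits Q) (Bits Q) ℂ) : Prop :=
  ∃ l : List (Matrix (Bits Q) (Bits Q) ℂ), l.length ≤ s ∧ (∀ g ∈ l, IsGate g) ∧ l.prod = M

/-- The matrix `U` on the qubits `Q` has quantum circuit complexity at most `s`: some circuit of
at most `s` gates on `Q` and some number `m` of ancilla qubits (possibly `m = 0`) maps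
`ψ ⊗ |0…0⟩` to `U ψ ⊗ |0…0⟩` for all `ψ`. -/
def ComplexityLE {Q : Type} [Fintype Q] [DecidableEq Q] (s : ℕ)
    (U : Matrix (Bits Q) (Bits Q) ℂ) : Prop :=
  ∃ (m : ℕ) (M : Matrix (Bits (Q ⊕ Fin m)) (Bits (Q ⊕ Fin m)) ℂ), HasCircuit s M ∧
    ∀ (x y : Bits Q) (z : Bits (Fin m)),
      M (Sum.elim y z) (Sum.elim x 0) = if z = 0 then U y x else 0

/-- The trace norm `‖A‖₁ = Tr √(A† A)`. -/
noncomputable def traceNorm {n : Type} [Fintype n] [DecidableEq n] (A : Matrix n n ℂ) : ℝ :=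
  (Matrix.trace (CFC.sqrt (Aᴴ * A))).re

/-- The partial trace over the second factor. -/
def traceSnd {m n : Type} [Fintype n] (A : Matrix (m × n) (m × n) ℂ) : Matrix m m ℂ :=
  fun i j => ∑ k, A (i, k) (j, k)

/-- The partial trace over the first factor. -/
def traceFst {m n : Type} [Fintype m] (A : Matrix (m × n) (m × n) ℂ) : Matrix n n ℂ :=
  fun i j => ∑ k, A (k, i) (k, j)

/-- The Hilbert space of `E H B`: early radiation `E` of `e` qubits, remaining black hole `H` of
`h` qubits, and a late outgoing mode `B` consisting of one qubit. -/
abbrev StateEHB (e h : ℕ) : Type :=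
  EuclideanSpace ℂ (Bits (Fin e) × Bits (Fin h) × Fin 2)

/-- The amplitudes, at a basis state of `O P E` and of `H` and of `B`, of the state
`U (|0⟩_O ⊗ |0⟩_P ⊗ |Ψ⟩_{EHB})`, where `U` acts on the observer `O` (`o` qubits), the probe `P`
(`p` qubits) and `E`. A circuit that prepares another initial state of the observer is to be
counted as the first part of `U`. -/
def evolved {o p e h : ℕ} (Ψ : StateEHB e h)
    (U : Matrix (Bits (Fin o ⊕ Fin p ⊕ Fin e)) (Bits (Fin o ⊕ Fin p ⊕ Fin e)) ℂ)
    (x : Bits (Fin o ⊕ Fin p ⊕ Fin e)) (j : Bits (Fin h)) (k : Fin 2) : ℂ :=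
  ∑ i : Bits (Fin e), U x (Sum.elim 0 (Sum.elim 0 i)) * Ψ (i, j, k)

/-- The reduced density operator `ρ_{OB}` of the evolved state. -/
noncomputable def rhoOB {o p e h : ℕ} (Ψ : StateEHB e h)
    (U : Matrix (Bits (Fin o ⊕ Fin p ⊕ Fin e)) (Bits (Fin o ⊕ Fin p ⊕ Fin e)) ℂ) :
    Matrix (Bits (Fin o) × Fin 2) (Bits (Fin o) × Fin 2) ℂ :=
  fun a b => ∑ q : Bits (Fin p), ∑ i : Bits (Fin e), ∑ j : Bits (Fin h),
    evolved Ψ U (Sum.elim a.1 (Sum.elim q i)) j a.2 *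
      star (evolved Ψ U (Sum.elim b.1 (Sum.elim q i)) j b.2)

/-- `‖ρ_{OB} - ρ_O ⊗ ρ_B‖₁ ≤ 6 · 2^{-(α|H| - |O|)}` for all observers and probes of any size that
interact with `E` by a circuit of at most `s` gates. -/
def DecoupledUpTo {e h : ℕ} (α : ℝ) (s : ℕ) (Ψ : StateEHB e h) : Prop :=
  ∀ (o p : ℕ) (U : Matrix (Bits (Fin o ⊕ Fin p ⊕ Fin e)) (Bits (Fin o ⊕ Fin p ⊕ Fin e)) ℂ),
    HasCircuit s U →
      traceNorm (rhoOB Ψ U - traceSnd (rhoOB Ψ U) ⊗ₖ traceFst (rhoOB Ψ U)) ≤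
        6 * (2 : ℝ) ^ (-(α * h - o))

/-- The decoupling bound for a family of black holes: for every polynomial `p` it holds for
circuits of size at most `p(|H|)`, once `|H|` is sufficiently large. -/
def DecouplingBound {ι : Type*} (α : ℝ) (e h : ι → ℕ) (Ψ : ∀ i, StateEHB (e i) (h i)) : Prop :=
  ∀ p : Polynomial ℕ, ∃ h₀ : ℕ, ∀ i, h₀ ≤ h i → DecoupledUpTo α (p.eval (h i)) (Ψ i)

/-- The map `V_Ψ = √d_B ∑ Ψ_{ijk} |i⟩_E |j⟩_H ⟨k|` from the interior mode to `E H`, with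
`d_B = 2`. -/
noncomputable def encodingMap {e h : ℕ} (Ψ : StateEHB e h) :
    Matrix (Bits (Fin e) × Bits (Fin h)) (Fin 2) ℂ :=
  fun x k => (Real.sqrt 2 : ℂ) * Ψ (x.1, x.2, k)

/-- `V` is a black hole code embedding for `Ψ`: an isometric embedding of the interior mode into
`E H` at operator norm distance at most `2 · 2^{-α|H|}` from `V_Ψ`. -/
def IsCodeEmbedding {e h : ℕ} (α : ℝ) (Ψ : StateEHB e h)
    (V : Matrix (Bits (Fin e) × Bits (Fin h)) (Fin 2) ℂ) : Prop :=
  Vᴴ * V = 1 ∧ ‖V - encodingMap Ψ‖ ≤ 2 * (2 : ℝ) ^ (-(α * h))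

/-- The operator `U ⊗ I_H` on `E H`. -/
def actE {e : ℕ} (h : ℕ) (U : Matrix (Bits (Fin e)) (Bits (Fin e)) ℂ) :
    Matrix (Bits (Fin e) × Bits (Fin h)) (Bits (Fin e) × Bits (Fin h)) ℂ :=
  U ⊗ₖ (1 : Matrix (Bits (Fin h)) (Bits (Fin h)) ℂ)

/-- `δ' = 8 · 6^{1/4} · 2^{-α|H|/4} · (N+1)^{3/4}`. -/
noncomputable def deltaPrime (α : ℝ) (h N : ℕ) : ℝ :=
  8 * (6 : ℝ) ^ (1 / 4 : ℝ) * (2 : ℝ) ^ (-(α * h) / 4) * ((N : ℝ) + 1) ^ (3 / 4 : ℝ)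

end BlackHole

open BlackHole

/-! Let `A`, `B` be low-complexity unitaries on `E`. A one-qubit observer in the state `|+⟩` can
control which of them is applied (`exists_interferometer`). The block of `ρ_{OB}` that is
off-diagonal in the observer is then, up to transposition, a quarter of `(A V_Ψ)ᴴ (B V_Ψ)`, so
decoupling makes this 2 × 2 matrix nearly a multiple of `V_Ψᴴ V_Ψ` (`decoupled_block`). Replacing
`V_Ψ` by the isometry `V` makes it nearly a multiple of the identity (`norm_gram_block_sub_le`).

Apply this to all pairs from `1, U_1, …, U_N`, and let `W` be the row of the maps `U_a V`. Then `Wᴴ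
W` is close to some `g ⊗ 1` with `g ≥ 0`, that is, `W` nearly factors through a tensor product with
the code qubit. With the polar decomposition `W = Q √(Wᴴ W)`, the operator `L = Q (1 ⊗ T) Qᴴ` acts
as `T` on every image `U_a V` at once, because `√(Wᴴ W)` is close to `√g ⊗ 1`, which commutes with
`1 ⊗ T` (`exists_logical`). The index of the identity gives `L V ≈ V T`; comparison with the index
`a` gives the commutator bound.

With `η = 2^{-α|H|}` the error is of order `(N+1) η^{1/2}`, which is below `δ'`, of order
`(N+1)^{3/4} η^{1/4}`, once `(N+1) η` is small. A polynomial `N` ensures this for large `|H|`. -/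

namespace BlackHole

/-! ### Continuity of the operator square root -/

/-- The square root is Hölder continuous of exponent `1/2` in a C⋆-algebra. -/
theorem norm_sqrt_sub_sqrt_le {A : Type*} [CStarAlgebra A] [PartialOrder A] [StarOrderedRing A]
    {a b : A} (ha : 0 ≤ a) (hb : 0 ≤ b) :
    ‖CFC.sqrt a - CFC.sqrt b‖ ≤ Real.sqrt ‖a - b‖ := by
  -- With `r² = ‖a - b‖`, one has `a ≤ b + r² ≤ (√b + r)²`; the square root is operator monotone.
  have key : ∀ {a b : A}, 0 ≤ a → 0 ≤ b →
      CFC.sqrt a ≤ CFC.sqrt b + algebraMap ℝ A (Real.sqrt ‖a - b‖) := by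
    intro a b ha hb
    have hsa : IsSelfAdjoint (a - b) :=
      (IsSelfAdjoint.of_nonneg ha).sub (IsSelfAdjoint.of_nonneg hb)
    have h1 : a - b ≤ algebraMap ℝ A ‖a - b‖ := hsa.le_algebraMap_norm_self
    set r := Real.sqrt ‖a - b‖
    have hr : 0 ≤ r := Real.sqrt_nonneg _
    have hrr : ‖a - b‖ = r * r := (Real.mul_self_sqrt (norm_nonneg _)).symm
    have hr' : 0 ≤ algebraMap ℝ A r := algebraMap_nonneg A hr
    have hc : 0 ≤ CFC.sqrt b + algebraMap ℝ A r := add_nonneg (CFC.sqrt_nonneg b) hr'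
    have h2 : a ≤ (CFC.sqrt b + algebraMap ℝ A r) * (CFC.sqrt b + algebraMap ℝ A r) := by
      have e : (CFC.sqrt b + algebraMap ℝ A r) * (CFC.sqrt b + algebraMap ℝ A r) =
          b + algebraMap ℝ A ‖a - b‖ + (2 * r) • CFC.sqrt b := by
        rw [mul_add, add_mul, add_mul, CFC.sqrt_mul_sqrt_self b hb, hrr, map_mul,
          ← Algebra.commutes r (CFC.sqrt b), Algebra.algebraMap_eq_smul_one, two_mul, add_smul]
        simp only [smul_mul_assoc, one_mul]
        abel
      rw [e]
      have h3 : 0 ≤ (2 * r) • CFC.sqrt b := smul_nonneg (by positivity) (CFC.sqrt_nonneg b)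
      calc a = b + (a - b) := by abel
        _ ≤ b + algebraMap ℝ A ‖a - b‖ := by gcongr
        _ ≤ _ := le_add_of_nonneg_right h3
    calc CFC.sqrt a ≤
          CFC.sqrt ((CFC.sqrt b + algebraMap ℝ A r) * (CFC.sqrt b + algebraMap ℝ A r)) :=
          CFC.sqrt_le_sqrt _ _ h2
      _ = _ := CFC.sqrt_mul_self _ hc
  have hsa : IsSelfAdjoint (CFC.sqrt a - CFC.sqrt b) :=
    (IsSelfAdjoint.of_nonneg (CFC.sqrt_nonneg a)).sub (IsSelfAdjoint.of_nonneg (CFC.sqrt_nonneg b))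
  have h1 := key ha hb
  have h2 := key hb ha
  rw [norm_sub_rev b a] at h2
  have h1' : CFC.sqrt a - CFC.sqrt b ≤ algebraMap ℝ A (Real.sqrt ‖a - b‖) := by
    rw [sub_le_iff_le_add']; exact h1
  have h2' : algebraMap ℝ A (-(Real.sqrt ‖a - b‖)) ≤ CFC.sqrt a - CFC.sqrt b := by
    rw [map_neg, neg_le_sub_iff_le_add]; exact h2
  rw [le_algebraMap_iff_spectrum_le] at h1'
  rw [algebraMap_le_iff_le_spectrum] at h2'
  rw [← cfc_id ℝ (CFC.sqrt a - CFC.sqrt b)]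
  exact norm_cfc_le (Real.sqrt_nonneg _) fun x hx => abs_le.2 ⟨h2' x hx, h1' x hx⟩

/-! ### Norm estimates, polar decomposition and approximate logical operators -/

section Matrix

set_option linter.unusedSectionVars false

variable {l m n : Type} [Fintype l] [DecidableEq l] [Fintype m] [DecidableEq m] [Fintype n]
  [DecidableEq n]

theorem conjTranspose_mul_self_nonneg (W : Matrix m n ℂ) : 0 ≤ Wᴴ * W := by
  open scoped ComplexOrder in
  exact (Matrix.posSemidef_conjTranspose_mul_self W).nonneg

/-- Polar decomposition of a rectangular matrix. -/
theorem exists_polar (W : Matrix m n ℂ) :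
    ∃ Q : Matrix m n ℂ, ‖Q‖ ≤ 1 ∧ Q * CFC.sqrt (Wᴴ * W) = W ∧ Qᴴ * W = CFC.sqrt (Wᴴ * W) := by
  have hG0 : 0 ≤ Wᴴ * W := conjTranspose_mul_self_nonneg W
  have hsa : IsSelfAdjoint (Wᴴ * W) := IsSelfAdjoint.of_nonneg hG0
  obtain ⟨G, hG⟩ : ∃ G, G = Wᴴ * W := ⟨_, rfl⟩
  rw [← hG] at hG0 hsa ⊢
  have hsp : ∀ x ∈ spectrum ℝ G, 0 ≤ x := fun x hx => spectrum_nonneg_of_nonneg hG0 hx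
  have hfin := Matrix.finite_real_spectrum (A := G)
  -- The spectrum is finite, so the functional calculus applies to discontinuous functions as well.
  have hco : ∀ f : ℝ → ℝ, ContinuousOn f (spectrum ℝ G) := fun f => hfin.continuousOn f
  have hs : CFC.sqrt G = cfc Real.sqrt G := by
    rw [CFC.sqrt_eq_real_sqrt G, cfcₙ_eq_cfc]
  -- Since `0⁻¹ = 0`, this is the pseudo-inverse of `√G`, and `W * F` is the partial isometry
  -- sought.
  obtain ⟨F, hF⟩ : ∃ F, F = cfc (fun x : ℝ => (Real.sqrt x)⁻¹) G := ⟨_, rfl⟩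
  have hFsa : Fᴴ = F := by
    rw [hF]
    exact (IsSelfAdjoint.cfc (f := fun x : ℝ => (Real.sqrt x)⁻¹) (a := G))
  have hFG : F * G = CFC.sqrt G := by
    rw [hs, hF]
    nth_rewrite 2 [← cfc_id ℝ G]
    rw [← cfc_mul _ _ G (hco _) (hco _)]
    refine cfc_congr fun x hx => ?_
    have := hsp x hx
    rcases this.eq_or_lt with h | h
    · simp [← h]
    · simp only [id]
      rw [inv_mul_eq_div, Real.div_sqrt]
  have hFsG : F * CFC.sqrt G = cfc (fun x : ℝ => if x = 0 then 0 else 1) G := by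
    rw [hs, hF, ← cfc_mul _ _ G (hco _) (hco _)]
    refine cfc_congr fun x hx => ?_
    have := hsp x hx
    rcases this.eq_or_lt with h | h
    · simp [← h]
    · have h' : Real.sqrt x ≠ 0 := (Real.sqrt_pos.2 h).ne'
      simp [h.ne', inv_mul_cancel₀ h']
  -- The projection onto the support of `G`, which is also that of `W`.
  obtain ⟨P, hP⟩ : ∃ P, P = cfc (fun x : ℝ => if x = 0 then (0 : ℝ) else 1) G := ⟨_, rfl⟩
  have hPsa : Pᴴ = P := by
    rw [hP]
    exact (IsSelfAdjoint.cfc (f := fun x : ℝ => if x = 0 then (0 : ℝ) else 1) (a := G))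
  have hGP : G * P = G := by
    rw [hP]
    nth_rewrite 1 [← cfc_id ℝ G]
    rw [← cfc_mul _ _ G (hco _) (hco _)]
    conv_rhs => rw [← cfc_id ℝ G]
    refine cfc_congr fun x hx => ?_
    by_cases h : x = 0 <;> simp [h]
  have hWP : W * P = W := by
    have : (W * P - W)ᴴ * (W * P - W) = 0 := by
      rw [Matrix.conjTranspose_sub, Matrix.conjTranspose_mul, hPsa, Matrix.sub_mul, Matrix.mul_sub,
        Matrix.mul_sub, Matrix.mul_assoc P, ← Matrix.mul_assoc Wᴴ, ← hG, hGP, Matrix.mul_assoc P,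
        ← hG]
      simp
    open scoped ComplexOrder in
    exact sub_eq_zero.1 (Matrix.conjTranspose_mul_self_eq_zero.1 this)
  refine ⟨W * F, ?_, ?_, ?_⟩
  · have h1 : (W * F)ᴴ * (W * F) = P := by
      rw [Matrix.conjTranspose_mul, hFsa, Matrix.mul_assoc, ← Matrix.mul_assoc Wᴴ, ← hG,
        ← Matrix.mul_assoc, hFG, hP, ← hFsG, hs, hF]
      exact cfc_commute_cfc _ _ _
    have h2 : ‖P‖ ≤ 1 := by
      rw [hP]
      refine norm_cfc_le zero_le_one fun x _ => ?_
      split_ifs <;> simp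
    have h3 := Matrix.l2_opNorm_conjTranspose_mul_self (W * F)
    rw [h1] at h3
    nlinarith [norm_nonneg (W * F)]
  · rw [Matrix.mul_assoc, hFsG, ← hP, hWP]
  · rw [Matrix.conjTranspose_mul, hFsa, Matrix.mul_assoc, ← hG, hFG]

theorem norm_le_one_of_isometry {V : Matrix m n ℂ} (hV : Vᴴ * V = 1) : ‖V‖ ≤ 1 := by
  have h3 := Matrix.l2_opNorm_conjTranspose_mul_self V
  have h1 : ‖(1 : Matrix n n ℂ)‖ ≤ 1 := by
    cases isEmpty_or_nonempty n
    · rw [Subsingleton.elim (1 : Matrix n n ℂ) 0]; simp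
    · rw [← Matrix.diagonal_one, Matrix.l2_opNorm_diagonal]
      exact (pi_norm_le_iff_of_nonneg zero_le_one).2 fun i => by simp
  rw [hV] at h3
  nlinarith [norm_nonneg V]

theorem norm_entry_le (A : Matrix m n ℂ) (i : m) (j : n) : ‖A i j‖ ≤ ‖A‖ := by
  have h := Matrix.l2_opNorm_mulVec A (EuclideanSpace.single j 1)
  have h2 := PiLp.norm_apply_le (p := 2)
    (WithLp.toLp 2 (A *ᵥ (EuclideanSpace.single j (1 : ℂ)).ofLp)) i
  simp only [PiLp.ofLp_single, Matrix.mulVec_single_one, Matrix.col_apply, PiLp.norm_single,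
    norm_one, mul_one] at h h2
  exact h2.trans h

theorem norm_single_le (i : m) (j : n) (c : ℂ) : ‖Matrix.single i j c‖ ≤ ‖c‖ := by
  have h3 := Matrix.l2_opNorm_conjTranspose_mul_self (Matrix.single i j c)
  have h4 : (Matrix.single i j c)ᴴ * Matrix.single i j c =
      Matrix.diagonal (Pi.single j (star c * c)) := by
    rw [Matrix.conjTranspose_single, Matrix.single_mul_single_same, Matrix.diagonal_single]
  rw [h4, Matrix.l2_opNorm_diagonal] at h3
  have h5 : ‖(Pi.single j (star c * c) : n → ℂ)‖ ≤ ‖c‖ * ‖c‖ := by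
    refine (pi_norm_le_iff_of_nonneg (by positivity)).2 fun k => ?_
    by_cases hk : k = j
    · subst hk; simp
    · simp [hk]; positivity
  rw [h3] at h5
  exact abs_le_of_sq_le_sq' (by nlinarith) (norm_nonneg c) |>.2

/-- A crude bound, but it loses only a factor polynomial in the size. This is the source of the
factor `(N+1)²` under the final square root. -/
theorem norm_le_of_entry_le (A : Matrix m n ℂ) {r : ℝ} (h : ∀ i j, ‖A i j‖ ≤ r) :
    ‖A‖ ≤ Fintype.card m * Fintype.card n * r := by
  rw [Matrix.matrix_eq_sum_single A]
  refine (norm_sum_le _ _).trans ?_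
  have : ∀ i ∈ (Finset.univ : Finset m), ‖∑ j, Matrix.single i j (A i j)‖ ≤ Fintype.card n * r := by
    intro i _
    refine (norm_sum_le _ _).trans ?_
    refine (Finset.sum_le_card_nsmul _ _ r fun j _ => (norm_single_le _ _ _).trans (h i j)).trans ?_
    simp
  refine (Finset.sum_le_card_nsmul _ _ _ this).trans ?_
  simp [mul_assoc]

theorem norm_le_trace_re {A : Matrix n n ℂ} (hA : 0 ≤ A) : ‖A‖ ≤ A.trace.re := by
  have hsa : IsSelfAdjoint A := IsSelfAdjoint.of_nonneg hA
  have hH : A.IsHermitian := hsa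
  have htr := hH.trace_eq_sum_eigenvalues
  have hnn : ∀ i, 0 ≤ hH.eigenvalues i := fun i =>
    spectrum_nonneg_of_nonneg hA (hH.eigenvalues_mem_spectrum_real i)
  have : A.trace.re = ∑ i, hH.eigenvalues i := by
    rw [htr]; simp
  rw [this]
  conv_lhs => rw [← cfc_id ℝ A]
  refine norm_cfc_le (Finset.sum_nonneg fun i _ => hnn i) fun x hx => ?_
  rw [hH.spectrum_real_eq_range_eigenvalues] at hx
  obtain ⟨i, rfl⟩ := hx
  rw [id, Real.norm_of_nonneg (hnn i)]
  exact Finset.single_le_sum (f := hH.eigenvalues) (fun i _ => hnn i) (Finset.mem_univ i)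

/-- `√(Aᴴ A)` has the same operator norm as `A`, and the norm of a positive matrix is at most its
trace. -/
theorem norm_le_traceNorm (A : Matrix n n ℂ) : ‖A‖ ≤ traceNorm A := by
  refine le_trans ?_ (norm_le_trace_re (CFC.sqrt_nonneg (Aᴴ * A)))
  have h := CStarRing.norm_star_mul_self (x := CFC.sqrt (Aᴴ * A))
  rw [(IsSelfAdjoint.of_nonneg (CFC.sqrt_nonneg (Aᴴ * A))).star_eq,
    CFC.sqrt_mul_sqrt_self _ (conjTranspose_mul_self_nonneg A),
    Matrix.l2_opNorm_conjTranspose_mul_self] at h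
  exact (mul_self_inj (norm_nonneg _) (norm_nonneg _)).1 h |>.le

/-- The amplification `A ↦ 1 ⊗ A` is a contraction. -/
theorem norm_one_kronecker_le (A : Matrix n n ℂ) : ‖(1 : Matrix m m ℂ) ⊗ₖ A‖ ≤ ‖A‖ := by
  let φ : Matrix n n ℂ →⋆ₙₐ[ℂ] Matrix (m × n) (m × n) ℂ :=
    { toFun := fun A => (1 : Matrix m m ℂ) ⊗ₖ A
      map_smul' := fun c A => by simp [Matrix.kronecker_smul]
      map_zero' := by simp
      map_add' := fun A B => by simp [Matrix.kronecker_add]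
      map_mul' := fun A B => by rw [← Matrix.mul_kronecker_mul, one_mul]
      map_star' := fun A => by
        rw [Matrix.star_eq_conjTranspose, Matrix.star_eq_conjTranspose,
          Matrix.conjTranspose_kronecker, Matrix.conjTranspose_one] }
  exact NonUnitalStarAlgHom.norm_apply_le φ A

/-- If the Gram matrix of `W` is close to `g ⊗ 1`, then each operator `1 ⊗ T` on its domain is
almost implemented on its range. -/
theorem exists_logical (W : Matrix l (m × n) ℂ) (g : Matrix m m ℂ) (hg : 0 ≤ g)
    (T : Matrix n n ℂ) :
    ∃ L : Matrix l l ℂ, ‖L * W - W * ((1 : Matrix m m ℂ) ⊗ₖ T)‖ ≤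
      2 * Real.sqrt ‖Wᴴ * W - g ⊗ₖ (1 : Matrix n n ℂ)‖ * ‖T‖ := by
  obtain ⟨Q, hQ, hQW, hQW'⟩ := exists_polar W
  obtain ⟨K, hK⟩ : ∃ K, K = (1 : Matrix m m ℂ) ⊗ₖ T := ⟨_, rfl⟩
  obtain ⟨S, hS⟩ : ∃ S, S = CFC.sqrt (Wᴴ * W) := ⟨_, rfl⟩
  obtain ⟨S₀, hS₀⟩ : ∃ S₀, S₀ = CFC.sqrt (g ⊗ₖ (1 : Matrix n n ℂ)) := ⟨_, rfl⟩
  have hKn : ‖K‖ ≤ ‖T‖ := hK ▸ norm_one_kronecker_le T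
  have hg1 : 0 ≤ g ⊗ₖ (1 : Matrix n n ℂ) := by
    open scoped ComplexOrder in
    exact (Matrix.PosSemidef.kronecker (Matrix.nonneg_iff_posSemidef.1 hg)
      Matrix.PosSemidef.one).nonneg
  have hd : ‖S - S₀‖ ≤ Real.sqrt ‖Wᴴ * W - g ⊗ₖ (1 : Matrix n n ℂ)‖ := by
    rw [hS, hS₀]
    exact norm_sqrt_sub_sqrt_le (conjTranspose_mul_self_nonneg W) hg1
  have hcomm : K * S₀ = S₀ * K := by
    have h1 : Commute (g ⊗ₖ (1 : Matrix n n ℂ)) K := by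
      rw [hK, commute_iff_eq, ← Matrix.mul_kronecker_mul, ← Matrix.mul_kronecker_mul]
      simp
    have h2 := h1.cfc_real Real.sqrt
    rw [hS₀, CFC.sqrt_eq_real_sqrt _, cfcₙ_eq_cfc]
    exact h2.eq.symm
  refine ⟨Q * K * Qᴴ, ?_⟩
  rw [← hK]
  -- The error is `Q [K, S]`, and `[K, S] = [K, S - S₀]` because `K` commutes with `S₀`.
  have e : Q * K * Qᴴ * W - W * K = Q * (K * (S - S₀) - (S - S₀) * K) := by
    rw [← hS] at hQW hQW'
    nth_rewrite 2 [← hQW]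
    rw [Matrix.mul_assoc _ Qᴴ, hQW', mul_sub, sub_mul, hcomm]
    simp only [Matrix.mul_sub, Matrix.mul_assoc]
    abel
  rw [e]
  have h1 : ‖K * (S - S₀) - (S - S₀) * K‖ ≤ 2 * ‖S - S₀‖ * ‖T‖ := by
    have a1 := norm_mul_le K (S - S₀)
    have a2 := norm_mul_le (S - S₀) K
    have a3 := norm_sub_le (K * (S - S₀)) ((S - S₀) * K)
    have a4 := mul_le_mul_of_nonneg_right hKn (norm_nonneg (S - S₀))
    nlinarith
  calc _ ≤ ‖Q‖ * ‖K * (S - S₀) - (S - S₀) * K‖ := Matrix.l2_opNorm_mul _ _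
    _ ≤ 1 * (2 * ‖S - S₀‖ * ‖T‖) := by gcongr
    _ ≤ _ := by rw [one_mul]; gcongr

end Matrix

/-! ### Matrices acting on embedded sets of qubits -/

section Act

set_option linter.unusedSectionVars false

variable {P Q R : Type}

/-- The basis labels `x` and `y` agree on all the qubits that are not in the image of `f`. -/
def AgreeOff (f : Q ↪ R) (x y : Bits R) : Prop := ∀ k, (∀ j, f j ≠ k) → x k = y k

open Classical in
/-- The matrix on the qubits `R` that acts as `M` on the qubits `Q`, embedded in `R` by `f`, and as
the identity on all the other qubits. -/
noncomputable def act (f : Q ↪ R) (M : Matrix (Bits Q) (Bits Q) ℂ) : Matrix (Bits R) (Bits R) ℂ :=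
  fun x y => if AgreeOff f x y then M (x ∘ f) (y ∘ f) else 0

theorem act_of_agreeOff {f : Q ↪ R} {x y : Bits R} (h : AgreeOff f x y)
    (M : Matrix (Bits Q) (Bits Q) ℂ) : act f M x y = M (x ∘ f) (y ∘ f) := if_pos h

theorem act_of_not_agreeOff {f : Q ↪ R} {x y : Bits R} (h : ¬ AgreeOff f x y)
    (M : Matrix (Bits Q) (Bits Q) ℂ) : act f M x y = 0 := if_neg h

theorem AgreeOff.symm {f : Q ↪ R} {x y : Bits R} (h : AgreeOff f x y) : AgreeOff f y x :=
  fun k hk => (h k hk).symm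

theorem AgreeOff.trans {f : Q ↪ R} {x y z : Bits R} (h : AgreeOff f x y) (h' : AgreeOff f y z) :
    AgreeOff f x z :=
  fun k hk => (h k hk).trans (h' k hk)

theorem agreeOff_extend (f : Q ↪ R) (x : Bits R) (u : Bits Q) :
    AgreeOff f x (Function.extend f u x) := fun k hk => by
  rw [Function.extend_apply']
  rintro ⟨j, hj⟩
  exact hk j hj

theorem AgreeOff.ext {f : Q ↪ R} {x y : Bits R} (h : AgreeOff f x y) (h' : x ∘ f = y ∘ f) :
    x = y := by
  funext k
  by_cases hk : ∃ j, f j = k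
  · obtain ⟨j, rfl⟩ := hk
    exact congrFun h' j
  · exact h k fun j hj => hk ⟨j, hj⟩

theorem agreeOff_trans_iff (f : P ↪ Q) (g : Q ↪ R) (x y : Bits R) :
    AgreeOff (f.trans g) x y ↔ AgreeOff g x y ∧ AgreeOff f (x ∘ g) (y ∘ g) := by
  constructor
  · intro h
    refine ⟨fun k hk => h k fun j => hk (f j), fun k hk => h (g k) fun j hj => ?_⟩
    exact hk j (g.injective hj)
  · rintro ⟨h, h'⟩ k hk
    by_cases hg : ∃ j, g j = k
    · obtain ⟨j, rfl⟩ := hg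
      exact h' j fun i hi => hk i (congrArg g hi)
    · exact h k fun j hj => hg ⟨j, hj⟩

variable [Fintype P] [DecidableEq P] [Fintype Q] [DecidableEq Q] [Fintype R] [DecidableEq R]

/-- The labels that agree with `x` off the image of `f` are exactly the `Function.extend f u x`, so
only these contribute. -/
theorem sum_act_mul (f : Q ↪ R) (M : Matrix (Bits Q) (Bits Q) ℂ) (x : Bits R) (v : Bits R → ℂ) :
    ∑ y, act f M x y * v y = ∑ u, M (x ∘ f) u * v (Function.extend f u x) := by
  classical
  symm
  refine Finset.sum_of_injOn (fun u => Function.extend f u x) ?_ ?_ ?_ ?_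
  · intro u _ u' _ h
    have := congrArg (· ∘ f) h
    simpa [Function.extend_comp f.injective] using this
  · intro u _; simp
  · intro y _ hy
    rw [act_of_not_agreeOff, zero_mul]
    intro h
    refine hy ⟨y ∘ f, by simp, ?_⟩
    refine (((agreeOff_extend f x _).symm.trans h).ext ?_)
    exact Function.extend_comp f.injective _ _
  · intro u _
    rw [act_of_agreeOff (agreeOff_extend f x u), Function.extend_comp f.injective]

theorem act_mul (f : Q ↪ R) (M N : Matrix (Bits Q) (Bits Q) ℂ) :
    act f (M * N) = act f M * act f N := by
  ext x z
  rw [Matrix.mul_apply, sum_act_mul]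
  by_cases h : AgreeOff f x z
  · rw [act_of_agreeOff h, Matrix.mul_apply]
    refine Finset.sum_congr rfl fun u _ => ?_
    rw [act_of_agreeOff ((agreeOff_extend f x u).symm.trans h), Function.extend_comp f.injective]
  · rw [act_of_not_agreeOff h, eq_comm]
    refine Finset.sum_eq_zero fun u _ => ?_
    rw [act_of_not_agreeOff, mul_zero]
    exact fun h' => h ((agreeOff_extend f x u).trans h')

theorem act_one (f : Q ↪ R) : act f (1 : Matrix (Bits Q) (Bits Q) ℂ) = 1 := by
  ext x y
  by_cases h : AgreeOff f x y
  · rw [act_of_agreeOff h]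
    by_cases h' : x ∘ f = y ∘ f
    · rw [h', h.ext h']; simp
    · rw [Matrix.one_apply_ne h', Matrix.one_apply_ne]
      rintro rfl; exact h' rfl
  · rw [act_of_not_agreeOff h, Matrix.one_apply_ne]
    rintro rfl; exact h fun _ _ => rfl

theorem act_conjTranspose (f : Q ↪ R) (M : Matrix (Bits Q) (Bits Q) ℂ) :
    act f Mᴴ = (act f M)ᴴ := by
  ext x y
  rw [Matrix.conjTranspose_apply]
  by_cases h : AgreeOff f x y
  · rw [act_of_agreeOff h, act_of_agreeOff h.symm, Matrix.conjTranspose_apply]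
  · rw [act_of_not_agreeOff h, act_of_not_agreeOff (fun h' => h h'.symm), star_zero]

theorem act_mem_unitaryGroup (f : Q ↪ R) {M : Matrix (Bits Q) (Bits Q) ℂ}
    (hM : M ∈ Matrix.unitaryGroup (Bits Q) ℂ) : act f M ∈ Matrix.unitaryGroup (Bits R) ℂ := by
  rw [Matrix.mem_unitaryGroup_iff, Matrix.star_eq_conjTranspose] at hM ⊢
  rw [← act_conjTranspose, ← act_mul, hM, act_one]

theorem act_act (f : P ↪ Q) (g : Q ↪ R) (M : Matrix (Bits P) (Bits P) ℂ) :
    act g (act f M) = act (f.trans g) M := by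
  ext x y
  by_cases h : AgreeOff g x y
  · rw [act_of_agreeOff h]
    by_cases h' : AgreeOff f (x ∘ g) (y ∘ g)
    · rw [act_of_agreeOff h', act_of_agreeOff ((agreeOff_trans_iff f g x y).2 ⟨h, h'⟩)]
      rfl
    · rw [act_of_not_agreeOff h', act_of_not_agreeOff]
      exact fun h'' => h' ((agreeOff_trans_iff f g x y).1 h'').2
  · rw [act_of_not_agreeOff h, act_of_not_agreeOff]
    exact fun h'' => h ((agreeOff_trans_iff f g x y).1 h'').1

theorem act_refl (M : Matrix (Bits Q) (Bits Q) ℂ) : act (Function.Embedding.refl Q) M = M := by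
  ext x y
  rw [act_of_agreeOff (fun k hk => absurd rfl (hk k))]
  rfl

theorem act_diagonal (f : Q ↪ R) (d : Bits Q → ℂ) :
    act f (Matrix.diagonal d) = Matrix.diagonal fun x => d (x ∘ f) := by
  ext x y
  by_cases h : AgreeOff f x y
  · rw [act_of_agreeOff h]
    by_cases h' : x ∘ f = y ∘ f
    · rw [h.ext h']; simp
    · rw [Matrix.diagonal_apply_ne _ h', Matrix.diagonal_apply_ne]
      rintro rfl; exact h' rfl
  · rw [act_of_not_agreeOff h, Matrix.diagonal_apply_ne]
    rintro rfl; exact h fun _ _ => rfl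

/-- Embeddings compose (`act_act`), subsets do not; hence all relabelling of qubits is done with
`act`. -/
theorem onQubits_eq_act (S : Finset Q) (G : Matrix (Bits S) (Bits S) ℂ) :
    onQubits S G = act (Function.Embedding.subtype (· ∈ S)) G := by
  ext x y
  have : (∀ k, k ∉ S → x k = y k) ↔ AgreeOff (Function.Embedding.subtype (· ∈ S)) x y := by
    refine forall_congr' fun k => imp_congr_left ⟨fun h j hj => h (hj ▸ j.2), fun h hk => ?_⟩
    exact h ⟨k, hk⟩ rfl
  unfold onQubits
  by_cases h : AgreeOff (Function.Embedding.subtype (· ∈ S)) x y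
  · rw [act_of_agreeOff h, if_pos (this.2 h)]; rfl
  · rw [act_of_not_agreeOff h, if_neg (fun h' => h (this.1 h'))]

theorem isGate_act (f : Q ↪ R) (hQ : Fintype.card Q ≤ 2) {G : Matrix (Bits Q) (Bits Q) ℂ}
    (hG : G ∈ Matrix.unitaryGroup (Bits Q) ℂ) : IsGate (act f G) := by
  let e : Q ↪ (Finset.univ.map f) := ⟨fun j => ⟨f j, by simp⟩, fun i j h => by simpa using h⟩
  refine ⟨Finset.univ.map f, by simpa using hQ, act e G, act_mem_unitaryGroup _ hG, ?_⟩
  rw [onQubits_eq_act, act_act]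
  rfl

theorem IsGate.exists_act {M : Matrix (Bits Q) (Bits Q) ℂ} (h : IsGate M) :
    ∃ S : Finset Q, S.card ≤ 2 ∧ ∃ G ∈ Matrix.unitaryGroup (Bits S) ℂ,
      M = act (Function.Embedding.subtype (· ∈ S)) G := by
  obtain ⟨S, hS, G, hG, rfl⟩ := h
  exact ⟨S, hS, G, hG, onQubits_eq_act S G⟩

theorem IsGate.act {M : Matrix (Bits Q) (Bits Q) ℂ} (h : IsGate M) (f : Q ↪ R) :
    IsGate (act f M) := by
  obtain ⟨S, hS, G, hG, rfl⟩ := h.exists_act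
  rw [act_act]
  exact isGate_act _ (by simpa using hS) hG

theorem IsGate.hasCircuit {M : Matrix (Bits Q) (Bits Q) ℂ} (h : IsGate M) : HasCircuit 1 M :=
  ⟨[M], by simp, by simpa using h, by simp⟩

theorem HasCircuit.mul {s t : ℕ} {M N : Matrix (Bits Q) (Bits Q) ℂ} (hM : HasCircuit s M)
    (hN : HasCircuit t N) : HasCircuit (s + t) (M * N) := by
  obtain ⟨l, hl, hg, rfl⟩ := hM
  obtain ⟨l', hl', hg', rfl⟩ := hN
  refine ⟨l ++ l', by simp; omega, fun g hh => ?_, by simp⟩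
  rcases List.mem_append.1 hh with hh | hh
  exacts [hg g hh, hg' g hh]

theorem HasCircuit.mono {s t : ℕ} {M : Matrix (Bits Q) (Bits Q) ℂ} (hM : HasCircuit s M)
    (hst : s ≤ t) : HasCircuit t M := by
  obtain ⟨l, hl, h⟩ := hM
  exact ⟨l, hl.trans hst, h⟩

/-- A multiplicative map that sends gates to circuits of at most `c` gates sends circuits of `s`
gates to circuits of at most `c * s` gates. -/
theorem HasCircuit.map {s c : ℕ} {M : Matrix (Bits Q) (Bits Q) ℂ} (hM : HasCircuit s M)
    (φ : Matrix (Bits Q) (Bits Q) ℂ →* Matrix (Bits R) (Bits R) ℂ)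
    (hφ : ∀ g, IsGate g → HasCircuit c (φ g)) : HasCircuit (c * s) (φ M) := by
  obtain ⟨l, hl, hg, rfl⟩ := hM
  refine HasCircuit.mono (s := c * l.length) ?_ (Nat.mul_le_mul_left c hl)
  clear hl
  induction l with
  | nil => exact ⟨[], by simp, by simp, by simp⟩
  | cons a l ih =>
    rw [List.prod_cons, map_mul, List.length_cons, mul_add, mul_one, add_comm]
    exact (hφ a (hg a (by simp))).mul (ih fun g hh => hg g (by simp [hh]))

theorem HasCircuit.act {s : ℕ} {M : Matrix (Bits Q) (Bits Q) ℂ} (hM : HasCircuit s M)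
    (f : Q ↪ R) : HasCircuit s (act f M) := by
  have := hM.map (c := 1) ⟨⟨BlackHole.act f, act_one f⟩, act_mul f⟩
    fun g hg => (hg.act f).hasCircuit
  simpa using this

end Act

/-! ### Controlled operations -/

section Control

variable {Q R : Type}

/-- The matrix that acts on the qubits `Q` as `F c` if the first qubit has the value `c`. -/
noncomputable def blk (F : Fin 2 → Matrix (Bits Q) (Bits Q) ℂ) :
    Matrix (Bits (Fin 1 ⊕ Q)) (Bits (Fin 1 ⊕ Q)) ℂ :=
  fun x y => act Function.Embedding.inr (F (x (Sum.inl 0))) x y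

theorem blk_apply (F : Fin 2 → Matrix (Bits Q) (Bits Q) ℂ) (x y : Bits (Fin 1 ⊕ Q)) :
    blk F x y = act Function.Embedding.inr (F (x (Sum.inl 0))) x y := rfl

theorem agreeOff_inr_iff {x y : Bits (Fin 1 ⊕ Q)} :
    AgreeOff Function.Embedding.inr x y ↔ x (Sum.inl 0) = y (Sum.inl 0) := by
  constructor
  · exact fun h => h _ fun j hj => by simp at hj
  · rintro h (k | k) hk
    · rw [Subsingleton.elim k 0]; exact h
    · exact absurd rfl (hk k)

theorem blk_const (M : Matrix (Bits Q) (Bits Q) ℂ) :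
    blk (fun _ => M) = act Function.Embedding.inr M := rfl

variable [Fintype Q] [DecidableEq Q] [Fintype R] [DecidableEq R]

theorem blk_mul (F G : Fin 2 → Matrix (Bits Q) (Bits Q) ℂ) :
    blk F * blk G = blk fun c => F c * G c := by
  ext x z
  rw [blk_apply, act_mul, Matrix.mul_apply, Matrix.mul_apply]
  refine Finset.sum_congr rfl fun y _ => ?_
  rw [blk_apply, blk_apply]
  by_cases h : AgreeOff Function.Embedding.inr x y
  · rw [agreeOff_inr_iff.1 h]
  · rw [act_of_not_agreeOff h, zero_mul, zero_mul]

theorem blk_conjTranspose (F : Fin 2 → Matrix (Bits Q) (Bits Q) ℂ) :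
    (blk F)ᴴ = blk fun c => (F c)ᴴ := by
  ext x y
  rw [blk_apply, act_conjTranspose, Matrix.conjTranspose_apply, Matrix.conjTranspose_apply,
    blk_apply]
  by_cases h : AgreeOff Function.Embedding.inr y x
  · rw [agreeOff_inr_iff.1 h]
  · rw [act_of_not_agreeOff h, act_of_not_agreeOff h]

theorem act_blk (f : Q ↪ R) (F : Fin 2 → Matrix (Bits Q) (Bits Q) ℂ) :
    act ((Function.Embedding.refl (Fin 1)).sumMap f) (blk F) = blk fun c => act f (F c) := by
  ext x y
  have h1 : act ((Function.Embedding.refl (Fin 1)).sumMap f) (blk F) x y =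
      act ((Function.Embedding.refl (Fin 1)).sumMap f)
        (act Function.Embedding.inr (F (x (Sum.inl 0)))) x y := rfl
  rw [h1, blk_apply, act_act, act_act]
  rfl

/-- The matrix `M` on the qubits `Q`, applied if the first qubit has the value `c`. -/
noncomputable def ctrl (c : Fin 2) (M : Matrix (Bits Q) (Bits Q) ℂ) :
    Matrix (Bits (Fin 1 ⊕ Q)) (Bits (Fin 1 ⊕ Q)) ℂ :=
  blk fun b => if b = c then M else 1

theorem ctrl_one (c : Fin 2) : ctrl c (1 : Matrix (Bits Q) (Bits Q) ℂ) = 1 := by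
  simp only [ctrl, ite_self, blk_const, act_one]

theorem ctrl_mul (c : Fin 2) (M N : Matrix (Bits Q) (Bits Q) ℂ) :
    ctrl c (M * N) = ctrl c M * ctrl c N := by
  rw [ctrl, ctrl, ctrl, blk_mul]
  congr 1
  funext b
  split_ifs <;> simp

theorem ctrl_conjTranspose (c : Fin 2) (M : Matrix (Bits Q) (Bits Q) ℂ) :
    (ctrl c M)ᴴ = ctrl c Mᴴ := by
  rw [ctrl, ctrl, blk_conjTranspose]
  congr 1
  funext b
  split_ifs <;> simp

theorem ctrl_mem_unitaryGroup (c : Fin 2) {M : Matrix (Bits Q) (Bits Q) ℂ}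
    (hM : M ∈ Matrix.unitaryGroup (Bits Q) ℂ) :
    ctrl c M ∈ Matrix.unitaryGroup (Bits (Fin 1 ⊕ Q)) ℂ := by
  rw [Matrix.mem_unitaryGroup_iff, Matrix.star_eq_conjTranspose] at hM ⊢
  rw [ctrl_conjTranspose, ← ctrl_mul, hM, ctrl_one]

theorem act_ctrl (c : Fin 2) (f : Q ↪ R) (M : Matrix (Bits Q) (Bits Q) ℂ) :
    act ((Function.Embedding.refl (Fin 1)).sumMap f) (ctrl c M) = ctrl c (act f M) := by
  rw [ctrl, ctrl, act_blk]
  congr 1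
  funext b
  split_ifs
  · rfl
  · exact act_one f

/-- If the control is off, `W` and `Wᴴ` cancel. So the conjugating unitary needs no control and
costs no additional qubit. -/
theorem ctrl_conj (c : Fin 2) {W : Matrix (Bits Q) (Bits Q) ℂ}
    (hW : W ∈ Matrix.unitaryGroup (Bits Q) ℂ) (M : Matrix (Bits Q) (Bits Q) ℂ) :
    ctrl c (W * M * Wᴴ) =
      act Function.Embedding.inr W * ctrl c M * act Function.Embedding.inr Wᴴ := by
  rw [Matrix.mem_unitaryGroup_iff, Matrix.star_eq_conjTranspose] at hW
  rw [ctrl, ctrl, ← blk_const, ← blk_const, blk_mul, blk_mul]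
  congr 1
  funext b
  split_ifs
  · rfl
  · rw [mul_one, hW]

theorem isGate_ctrl (c : Fin 2) (hQ : Fintype.card Q ≤ 1) {M : Matrix (Bits Q) (Bits Q) ℂ}
    (hM : M ∈ Matrix.unitaryGroup (Bits Q) ℂ) : IsGate (ctrl c M) := by
  rw [← act_refl (ctrl c M)]
  exact isGate_act _ (by simp; omega) (ctrl_mem_unitaryGroup c hM)

end Control

/-! ### Controlled two-qubit gates as products of seven gates -/

section TwoQubit

/-- The Hermitian matrix `A = arg G` satisfies `G = exp (i A)`, so the spectral theorem for `A`
diagonalizes `G`. The jump of `arg` is harmless on a finite spectrum. -/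
theorem exists_diagonalization {n : Type} [Fintype n] [DecidableEq n] {G : Matrix n n ℂ}
    (hG : G ∈ Matrix.unitaryGroup n ℂ) :
    ∃ W ∈ Matrix.unitaryGroup n ℂ, ∃ θ : n → ℝ,
      G = W * Matrix.diagonal (fun i => Complex.exp (θ i * Complex.I)) * Wᴴ := by
  have hn : IsStarNormal G := ⟨by
    rw [commute_iff_eq, (Matrix.mem_unitaryGroup_iff'.1 hG), (Matrix.mem_unitaryGroup_iff.1 hG)]⟩
  have hco : ∀ f : ℂ → ℂ, ContinuousOn f (spectrum ℂ G) := fun f =>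
    (Matrix.finite_spectrum G).continuousOn f
  have hsp : ∀ z ∈ spectrum ℂ G, ‖z‖ = 1 := fun z hz => by
    simpa using spectrum.subset_circle_of_unitary (𝕜 := ℂ) hG hz
  obtain ⟨A, hA⟩ : ∃ A, A = cfc (fun z : ℂ => (z.arg : ℂ)) G := ⟨_, rfl⟩
  have hAH : A.IsHermitian := by
    rw [hA]
    show star _ = _
    rw [← cfc_star]
    simp
  have hexp : G = NormedSpace.exp (Complex.I • A) := by
    have hnA : IsStarNormal A := by rw [hA]; exact cfc_predicate _ _
    have hnI : IsStarNormal (Complex.I • A) := by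
      rw [hA, ← cfc_smul _ _ _ (hco _)]; exact cfc_predicate _ _
    rw [← CFC.exp_eq_normedSpace_exp (𝕜 := ℂ) hnI, hA, ← cfc_smul _ _ _ (hco _),
      ← cfc_comp' _ _ _ ?_ (hco _)]
    · conv_lhs => rw [← cfc_id ℂ G]
      refine cfc_congr fun z hz => ?_
      rw [← Complex.exp_eq_exp_ℂ, smul_eq_mul, mul_comm]
      have := Complex.norm_mul_exp_arg_mul_I z
      rw [hsp z hz] at this
      simpa using this.symm
    · rw [← Complex.exp_eq_exp_ℂ]
      exact Complex.continuous_exp.continuousOn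
  obtain ⟨W, θ, h1⟩ : ∃ (W : Matrix.unitaryGroup n ℂ) (θ : n → ℝ),
      A = W * Matrix.diagonal (fun i => (θ i : ℂ)) * star (W : Matrix n n ℂ) :=
    ⟨hAH.eigenvectorUnitary, hAH.eigenvalues, hAH.spectral_theorem⟩
  refine ⟨W, W.2, θ, ?_⟩
  have h2 : Complex.I • A = (Unitary.toUnits W : Matrix n n ℂ) *
      Matrix.diagonal (fun i => θ i * Complex.I) *
      ((Unitary.toUnits W)⁻¹ : (Matrix n n ℂ)ˣ) := by
    have : (fun i => (θ i : ℂ) * Complex.I) = Complex.I • fun i => (θ i : ℂ) := by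
      funext i
      simp [mul_comm]
    rw [h1, ← Matrix.smul_mul, ← Matrix.mul_smul, ← Matrix.diagonal_smul, this]
    rfl
  rw [hexp, h2, Matrix.exp_units_conj, Matrix.exp_diagonal]
  have h3 : NormedSpace.exp (fun i => (θ i : ℂ) * Complex.I) =
      fun i => Complex.exp (θ i * Complex.I) := by
    funext i
    rw [Pi.coe_exp, Complex.exp_eq_exp_ℂ]
  rw [h3]
  rfl

theorem diagonal_mem_unitaryGroup {n : Type} [Fintype n] [DecidableEq n] (θ : n → ℝ) :
    Matrix.diagonal (fun i => Complex.exp (θ i * Complex.I)) ∈ Matrix.unitaryGroup n ℂ := by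
  rw [Matrix.mem_unitaryGroup_iff, Matrix.star_eq_conjTranspose, Matrix.diagonal_conjTranspose,
    Matrix.diagonal_mul_diagonal, ← Matrix.diagonal_one]
  congr 1
  funext i
  simp only [Pi.star_apply, RCLike.star_def]
  rw [Complex.mul_conj, Complex.normSq_eq_norm_sq, Complex.norm_exp_ofReal_mul_I]
  simp

/-- The embedding of one qubit as the qubit `j`. -/
def qubit {Q : Type} (j : Q) : Fin 1 ↪ Q := ⟨fun _ => j, fun _ _ _ => Subsingleton.elim _ _⟩

theorem qubit_apply {Q : Type} (j : Q) (i : Fin 1) : qubit j i = j := rfl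

/-- The permutation of the basis labels of two qubits that a CNOT gate performs. -/
def cnotPerm : Equiv.Perm (Bits (Fin 2)) where
  toFun x := ![x 0, x 0 + x 1]
  invFun x := ![x 0, x 0 + x 1]
  left_inv := by decide
  right_inv := by decide

theorem permMatrix_mem_unitaryGroup {n : Type} [Fintype n] [DecidableEq n] (σ : Equiv.Perm n) :
    σ.permMatrix ℂ ∈ Matrix.unitaryGroup n ℂ := by
  rw [Matrix.mem_unitaryGroup_iff, Matrix.star_eq_conjTranspose, Matrix.conjTranspose_permMatrix,
    ← Matrix.permMatrix_mul]
  simp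

theorem permMatrix_conj_diagonal {n : Type} [Fintype n] [DecidableEq n] (σ : Equiv.Perm n)
    (d : n → ℂ) :
    σ.permMatrix ℂ * Matrix.diagonal d * (σ.permMatrix ℂ)ᴴ = Matrix.diagonal (d ∘ σ) := by
  rw [Matrix.conjTranspose_permMatrix, Equiv.Perm.permMatrix, Equiv.Perm.permMatrix,
    PEquiv.toMatrix_toPEquiv_mul, PEquiv.mul_toMatrix_toPEquiv, Matrix.submatrix_submatrix]
  exact Matrix.submatrix_diagonal_equiv d σ

/-- A diagonal unitary on two qubits is a product of one-qubit diagonal unitaries, one of them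
conjugated with a CNOT gate. -/
theorem diagonal_two_qubits (θ : Bits (Fin 2) → ℝ) : ∃ a b d : Bits (Fin 1) → ℝ,
    Matrix.diagonal (fun x => Complex.exp (θ x * Complex.I)) =
      act (qubit 0) (Matrix.diagonal (fun x => Complex.exp (a x * Complex.I))) *
      act (qubit 1) (Matrix.diagonal (fun x => Complex.exp (b x * Complex.I))) *
      (cnotPerm.permMatrix ℂ *
        act (qubit 1) (Matrix.diagonal (fun x => Complex.exp (d x * Complex.I))) *
        (cnotPerm.permMatrix ℂ)ᴴ) := by
  -- The exponent is to be `a(x₀) + b(x₁) + d(x₀ + x₁)`; `t` is the parity part of `θ`. The phase `θ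
  -- ![0, 0]` is put into `b`: a global phase matters once the gate is controlled.
  let t := (θ ![0, 1] + θ ![1, 0] - θ ![0, 0] - θ ![1, 1]) / 2
  refine ⟨fun x => if x 0 = 0 then 0 else θ ![1, 0] - θ ![0, 0] - t,
    fun x => if x 0 = 0 then θ ![0, 0] else θ ![0, 1] - t, fun x => if x 0 = 0 then 0 else t, ?_⟩
  rw [act_diagonal, act_diagonal, act_diagonal, permMatrix_conj_diagonal,
    Matrix.diagonal_mul_diagonal, Matrix.diagonal_mul_diagonal]
  congr 1
  funext x
  simp only [Function.comp_apply]
  rw [← Complex.exp_add, ← Complex.exp_add, ← add_mul, ← add_mul, ← Complex.ofReal_add,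
    ← Complex.ofReal_add]
  congr 3
  obtain ⟨u, v, rfl⟩ : ∃ u v, x = ![u, v] := ⟨x 0, x 1, by funext i; fin_cases i <;> rfl⟩
  fin_cases u <;> fin_cases v <;> simp [cnotPerm, qubit_apply, t] <;> ring

/-- The seven gates are `W`, two controlled one-qubit phases, CNOT, a third controlled phase, CNOT
and `Wᴴ`. -/
theorem hasCircuit_ctrl_two_qubits (c : Fin 2) {G : Matrix (Bits (Fin 2)) (Bits (Fin 2)) ℂ}
    (hG : G ∈ Matrix.unitaryGroup (Bits (Fin 2)) ℂ) : HasCircuit 7 (ctrl c G) := by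
  obtain ⟨W, hW, θ, rfl⟩ := exists_diagonalization hG
  obtain ⟨a, b, d, h⟩ := diagonal_two_qubits θ
  have hK := permMatrix_mem_unitaryGroup cnotPerm
  have h2 : ∀ M ∈ Matrix.unitaryGroup (Bits (Fin 2)) ℂ,
      HasCircuit 1 (act (Function.Embedding.inr : Fin 2 ↪ Fin 1 ⊕ Fin 2) M) :=
    fun M hM => (isGate_act _ (by simp) hM).hasCircuit
  have h1 : ∀ (j : Fin 2) (a : Bits (Fin 1) → ℝ),
      HasCircuit 1 (ctrl c (act (qubit j)
        (Matrix.diagonal fun x => Complex.exp (a x * Complex.I)))) := by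
    intro j a
    rw [← act_ctrl]
    exact ((isGate_ctrl c (by simp) (diagonal_mem_unitaryGroup a)).act _).hasCircuit
  rw [ctrl_conj c hW, h, ctrl_mul, ctrl_mul, ctrl_conj c hK]
  exact ((h2 _ hW).mul (((h1 0 a).mul (h1 1 b)).mul (((h2 _ hK).mul (h1 1 d)).mul
    (h2 _ (Unitary.star_mem hK))))).mul (h2 _ (Unitary.star_mem hW))

variable {Q : Type} [Fintype Q] [DecidableEq Q]

theorem IsGate.hasCircuit_ctrl (c : Fin 2) {M : Matrix (Bits Q) (Bits Q) ℂ} (h : IsGate M) :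
    HasCircuit 7 (ctrl c M) := by
  obtain ⟨S, hS, G, hG, rfl⟩ := h.exists_act
  rw [← act_ctrl]
  refine HasCircuit.act ?_ _
  rcases Nat.lt_or_ge S.card 2 with h1 | h2
  · exact (isGate_ctrl c (by simp; omega) hG).hasCircuit.mono (by norm_num)
  · have e : Fin 2 ≃ S := (Fintype.equivFinOfCardEq (by simp; omega)).symm
    have : G = BlackHole.act e.toEmbedding (BlackHole.act e.symm.toEmbedding G) := by
      rw [act_act, ← Equiv.trans_toEmbedding, Equiv.symm_trans_self]
      exact (act_refl G).symm
    rw [this, ← act_ctrl]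
    exact (hasCircuit_ctrl_two_qubits c (act_mem_unitaryGroup _ hG)).act _

theorem HasCircuit.ctrl (c : Fin 2) {s : ℕ} {M : Matrix (Bits Q) (Bits Q) ℂ}
    (h : HasCircuit s M) : HasCircuit (7 * s) (ctrl c M) :=
  h.map ⟨⟨BlackHole.ctrl c, ctrl_one c⟩, ctrl_mul c⟩ fun _ hg => hg.hasCircuit_ctrl c

end TwoQubit

/-! ### The interferometer circuit -/

section Interferometer

/-- The embedding of `E` and `m` ancillas into the probe, of `p ≥ m` qubits, and `E`. -/
def probeEmbedding {e m p : ℕ} (h : m ≤ p) : Fin e ⊕ Fin m ↪ Fin p ⊕ Fin e where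
  toFun := Sum.elim Sum.inr fun j => Sum.inl (Fin.castLE h j)
  inj' := by
    rintro (i | i) (j | j) hij <;> simp_all

/-- The ancillas of the implementation become probe qubits, which start and end in `|0⟩`; the
surplus probe qubits are untouched. -/
theorem act_probeEmbedding {e m p : ℕ} (h : m ≤ p) {U : Matrix (Bits (Fin e)) (Bits (Fin e)) ℂ}
    {M : Matrix (Bits (Fin e ⊕ Fin m)) (Bits (Fin e ⊕ Fin m)) ℂ}
    (hM : ∀ (x y : Bits (Fin e)) (z : Bits (Fin m)),
      M (Sum.elim y z) (Sum.elim x 0) = if z = 0 then U y x else 0)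
    (q : Bits (Fin p)) (i i' : Bits (Fin e)) :
    act (probeEmbedding h) M (Sum.elim q i') (Sum.elim 0 i) = if q = 0 then U i' i else 0 := by
  have e1 : ∀ (q : Bits (Fin p)) (i : Bits (Fin e)),
      (Sum.elim q i ∘ probeEmbedding h : Bits (Fin e ⊕ Fin m)) =
        Sum.elim i (fun j => q (Fin.castLE h j)) := by
    intro q i
    funext k
    rcases k with k | k <;> rfl
  by_cases hq : q = 0
  · subst hq
    rw [act_of_agreeOff, e1, e1]
    · exact (hM i i' _).trans (by rw [if_pos rfl, if_pos]; rfl)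
    · rintro (k | k) hk
      · rfl
      · exact absurd rfl (hk (Sum.inl k))
  · rw [if_neg hq]
    by_cases ha : AgreeOff (probeEmbedding h) (Sum.elim q i' : Bits (Fin p ⊕ Fin e)) (Sum.elim 0 i)
    · rw [act_of_agreeOff ha, e1, e1]
      refine (hM i i' _).trans (if_neg fun h0 => hq ?_)
      funext k
      -- The first `m` probe qubits vanish by `h0`, the others because they agree with the input.
      by_cases hk : (k : ℕ) < m
      · exact congrFun h0 ⟨k, hk⟩
      · refine ha (Sum.inl k) ?_
        rintro (j | j) hj
        · cases hj
        · refine hk ?_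
          have := Sum.inl.inj hj
          rw [← this]
          exact j.2
    · rw [act_of_not_agreeOff ha]

/-- The Hadamard gate. -/
noncomputable def hadamard : Matrix (Bits (Fin 1)) (Bits (Fin 1)) ℂ :=
  fun x y => (Real.sqrt 2 : ℂ)⁻¹ * if x 0 = 1 ∧ y 0 = 1 then -1 else 1

theorem hadamard_mem_unitaryGroup : hadamard ∈ Matrix.unitaryGroup (Bits (Fin 1)) ℂ := by
  have h2 : (Real.sqrt 2 : ℂ)⁻¹ * (Real.sqrt 2 : ℂ)⁻¹ = 1 / 2 := by
    rw [← mul_inv, ← Complex.ofReal_mul, Real.mul_self_sqrt zero_le_two]; norm_num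
  rw [Matrix.mem_unitaryGroup_iff]
  ext x y
  rw [Matrix.mul_apply, Fintype.sum_equiv (Equiv.funUnique (Fin 1) (Fin 2)) _
    (fun b => hadamard x (fun _ => b) * star (hadamard y (fun _ => b)))]
  · obtain ⟨a, rfl⟩ : ∃ a, x = fun _ => a := ⟨x 0, by funext i; rw [Subsingleton.elim i 0]⟩
    obtain ⟨b, rfl⟩ : ∃ a, y = fun _ => a := ⟨y 0, by funext i; rw [Subsingleton.elim i 0]⟩
    rw [Fin.sum_univ_two, Matrix.one_apply]
    fin_cases a <;> fin_cases b <;> simp [hadamard, funext_iff, h2] <;> norm_num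
  · intro b
    have : (fun _ => (Equiv.funUnique (Fin 1) (Fin 2)) b) = b := by
      funext i; rw [Subsingleton.elim i 0]; rfl
    rw [this]
    rfl

theorem blk_mul_act_inl {Q : Type} [Fintype Q] [DecidableEq Q]
    (F : Fin 2 → Matrix (Bits Q) (Bits Q) ℂ) (G : Matrix (Bits (Fin 1)) (Bits (Fin 1)) ℂ)
    (a b : Bits (Fin 1)) (u v : Bits Q) :
    (blk F * act (Function.Embedding.inl : Fin 1 ↪ Fin 1 ⊕ Q) G) (Sum.elim a u) (Sum.elim b v) =
      F (a 0) u v * G a b := by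
  have h1 : ∀ w : Bits Q, Function.extend (Function.Embedding.inr : Q ↪ Fin 1 ⊕ Q) w
      (Sum.elim a u : Bits (Fin 1 ⊕ Q)) = Sum.elim a w := by
    intro w
    funext k
    rcases k with k | k
    · rw [Function.extend_apply']
      · rfl
      · rintro ⟨j, hj⟩; cases hj
    · exact (Function.Embedding.inr : Q ↪ Fin 1 ⊕ Q).injective.extend_apply _ _ _
  have h2 : ∀ w : Bits Q, act Function.Embedding.inl G (Sum.elim a w : Bits (Fin 1 ⊕ Q))
      (Sum.elim b v) = if w = v then G a b else 0 := by
    intro w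
    by_cases hw : w = v
    · rw [if_pos hw, act_of_agreeOff]
      · rfl
      · rintro (k | k) hk
        · exact absurd rfl (hk k)
        · exact congrFun hw k
    · rw [if_neg hw, act_of_not_agreeOff]
      exact fun h => hw (funext fun k => h (Sum.inr k) (by rintro j hj; cases hj))
  rw [Matrix.mul_apply]
  simp only [blk_apply]
  rw [sum_act_mul]
  simp only [h1, h2, mul_ite, mul_zero, Finset.sum_ite_eq', Finset.mem_univ, if_true]
  rfl

/-- A circuit that takes `|0⟩_O |0⟩_P ψ` to `(|0⟩_O |0⟩_P A ψ + |1⟩_O |0⟩_P B ψ) / √2`. -/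
theorem exists_interferometer {e s : ℕ} {A B : Matrix (Bits (Fin e)) (Bits (Fin e)) ℂ}
    (hA : ComplexityLE s A) (hB : ComplexityLE s B) :
    ∃ (p : ℕ) (U : Matrix (Bits (Fin 1 ⊕ Fin p ⊕ Fin e)) (Bits (Fin 1 ⊕ Fin p ⊕ Fin e)) ℂ),
      HasCircuit (14 * s + 1) U ∧ ∀ (a : Bits (Fin 1)) (q : Bits (Fin p)) (i' i : Bits (Fin e)),
        U (Sum.elim a (Sum.elim q i')) (Sum.elim 0 (Sum.elim 0 i)) =
          if q = 0 then (Real.sqrt 2 : ℂ)⁻¹ * (if a 0 = 0 then A else B) i' i else 0 := by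
  obtain ⟨m, M, hMc, hM⟩ := hA
  obtain ⟨n, N, hNc, hN⟩ := hB
  have hM' := act_probeEmbedding (le_max_left m n) hM
  have hN' := act_probeEmbedding (le_max_right m n) hN
  have hMc' := (hMc.act (probeEmbedding (le_max_left m n))).ctrl 0
  have hNc' := (hNc.act (probeEmbedding (le_max_right m n))).ctrl 1
  generalize act (probeEmbedding (le_max_left m n)) M = M' at hM' hMc'
  generalize act (probeEmbedding (le_max_right m n)) N = N' at hN' hNc'
  -- The rightmost factor acts first. Both branches can share the probe since each returns it to
  -- `|0⟩`. The size is `7 s + 7 s + 1`.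
  refine ⟨max m n, ctrl 0 M' * ctrl 1 N' * act Function.Embedding.inl hadamard, ?_, ?_⟩
  · refine ((hMc'.mul hNc').mul (isGate_act _ (by simp)
      hadamard_mem_unitaryGroup).hasCircuit).mono ?_
    omega
  · intro a q i' i
    have : ctrl 0 M' * ctrl 1 N' = blk (fun c => if c = 0 then M' else N') := by
      rw [ctrl, ctrl, blk_mul]
      congr 1
      funext c
      fin_cases c <;> simp
    rw [this]
    refine (blk_mul_act_inl _ _ _ _ _ _).trans ?_
    have hh : hadamard a 0 = (Real.sqrt 2 : ℂ)⁻¹ := by simp [hadamard]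
    rw [hh, mul_comm]
    split_ifs with h0 hq hq
    · rw [hM', if_pos hq]
    · rw [hM', if_neg hq, mul_zero]
    · rw [hN', if_pos hq]
    · rw [hN', if_neg hq, mul_zero]

end Interferometer

/-! ### From the decoupling bound to Gram blocks of `V_Ψ` -/

section Decoupling

variable {e h : ℕ}

theorem actE_mul (A B : Matrix (Bits (Fin e)) (Bits (Fin e)) ℂ) :
    actE h (A * B) = actE h A * actE h B := by
  rw [actE, actE, actE, ← Matrix.mul_kronecker_mul, one_mul]

theorem actE_one : actE h (1 : Matrix (Bits (Fin e)) (Bits (Fin e)) ℂ) = 1 := by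
  rw [actE, Matrix.one_kronecker_one]

theorem actE_conjTranspose (A : Matrix (Bits (Fin e)) (Bits (Fin e)) ℂ) :
    (actE h A)ᴴ = actE h Aᴴ := by
  rw [actE, actE, Matrix.conjTranspose_kronecker, Matrix.conjTranspose_one]

theorem actE_conjTranspose_mul_self {A : Matrix (Bits (Fin e)) (Bits (Fin e)) ℂ}
    (hA : A ∈ Matrix.unitaryGroup (Bits (Fin e)) ℂ) : (actE h A)ᴴ * actE h A = 1 := by
  rw [Matrix.mem_unitaryGroup_iff', Matrix.star_eq_conjTranspose] at hA
  rw [actE_conjTranspose, ← actE_mul, hA, actE_one]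

theorem actE_mul_apply {n : Type} (A : Matrix (Bits (Fin e)) (Bits (Fin e)) ℂ)
    (X : Matrix (Bits (Fin e) × Bits (Fin h)) n ℂ) (i : Bits (Fin e)) (j : Bits (Fin h)) (k : n) :
    (actE h A * X) (i, j) k = ∑ i', A i i' * X (i', j) k := by
  rw [Matrix.mul_apply, Fintype.sum_prod_type]
  refine Finset.sum_congr rfl fun i' _ => ?_
  rw [Finset.sum_eq_single j]
  · rw [actE, Matrix.kronecker_apply, Matrix.one_apply_eq, mul_one]
  · intro j' _ hj
    rw [actE, Matrix.kronecker_apply, Matrix.one_apply_ne hj.symm, mul_zero, zero_mul]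
  · simp

/-- The joint state of the observer and the late mode after an interferometer circuit. -/
theorem rhoOB_interferometer {p : ℕ} (Ψ : StateEHB e h)
    {U : Matrix (Bits (Fin 1 ⊕ Fin p ⊕ Fin e)) (Bits (Fin 1 ⊕ Fin p ⊕ Fin e)) ℂ}
    {F : Bits (Fin 1) → Matrix (Bits (Fin e)) (Bits (Fin e)) ℂ}
    (hU : ∀ (a : Bits (Fin 1)) (q : Bits (Fin p)) (i' i : Bits (Fin e)),
        U (Sum.elim a (Sum.elim q i')) (Sum.elim 0 (Sum.elim 0 i)) =
          if q = 0 then (Real.sqrt 2 : ℂ)⁻¹ * F a i' i else 0) (a b : Bits (Fin 1) × Fin 2) :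
    rhoOB Ψ U a b = 1 / 4 * ((actE h (F b.1) * encodingMap Ψ)ᴴ *
      (actE h (F a.1) * encodingMap Ψ)) b.2 a.2 := by
  -- `V_Ψ` carries a factor `√2`, so amplitudes with the prefactor `1/√2` are halves of entries of
  -- `V_Ψ`.
  have h2 : (Real.sqrt 2 : ℂ)⁻¹ = 1 / 2 * (Real.sqrt 2 : ℂ) := by
    have : (Real.sqrt 2 : ℂ) * (Real.sqrt 2 : ℂ) = 2 := by
      rw [← Complex.ofReal_mul, Real.mul_self_sqrt zero_le_two]; norm_num
    have h0 : (Real.sqrt 2 : ℂ) ≠ 0 := by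
      intro h; rw [h] at this; norm_num at this
    field_simp
    rw [sq, this]
  have hev : ∀ (a : Bits (Fin 1)) q i j k, evolved Ψ U (Sum.elim a (Sum.elim q i)) j k =
      if q = 0 then 1 / 2 * (actE h (F a) * encodingMap Ψ) (i, j) k else 0 := by
    intro a q i j k
    simp only [evolved, hU]
    split_ifs
    · rw [actE_mul_apply, Finset.mul_sum]
      refine Finset.sum_congr rfl fun i' _ => ?_
      rw [encodingMap, h2]
      ring
    · simp
  unfold rhoOB
  rw [Finset.sum_eq_single 0]
  · simp only [hev, if_true]
    rw [Matrix.mul_apply, Fintype.sum_prod_type, Finset.mul_sum]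
    refine Finset.sum_congr rfl fun i _ => ?_
    rw [Finset.mul_sum]
    refine Finset.sum_congr rfl fun j _ => ?_
    rw [Matrix.conjTranspose_apply, star_mul']
    simp
    ring
  · intro q _ hq
    simp [hev, hq]
  · simp

/-- The off-diagonal observer block of `ρ_{OB} - ρ_O ⊗ ρ_B` is read off entrywise. The constant is
`6 · 2 = 12` for one observer qubit, times 4 to undo the normalization `1/4` of `ρ_{OB}`. -/
theorem decoupled_block {α : ℝ} {s : ℕ} {Ψ : StateEHB e h}
    (hd : DecoupledUpTo α (14 * s + 1) Ψ) {A B : Matrix (Bits (Fin e)) (Bits (Fin e)) ℂ}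
    (hA : A ∈ Matrix.unitaryGroup (Bits (Fin e)) ℂ) (hB : B ∈ Matrix.unitaryGroup (Bits (Fin e)) ℂ)
    (hAc : ComplexityLE s A) (hBc : ComplexityLE s B) (l k : Fin 2) :
    ‖((actE h A * encodingMap Ψ)ᴴ * (actE h B * encodingMap Ψ)) l k -
      ((actE h A * encodingMap Ψ)ᴴ * (actE h B * encodingMap Ψ)).trace / 2 *
        ((encodingMap Ψ)ᴴ * encodingMap Ψ) l k‖ ≤ 48 * (2 : ℝ) ^ (-(α * h)) := by
  obtain ⟨p, U, hUc, hU⟩ := exists_interferometer hAc hBc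
  have hρ := rhoOB_interferometer Ψ (F := fun a => if a 0 = 0 then A else B) hU
  have h1 := (norm_entry_le _ ((fun _ => 1 : Bits (Fin 1)), k) ((0 : Bits (Fin 1)), l)).trans
    ((norm_le_traceNorm _).trans (hd 1 p U hUc))
  have hrhs : 6 * (2 : ℝ) ^ (-(α * h - (1 : ℕ))) = 12 * (2 : ℝ) ^ (-(α * h)) := by
    rw [show -(α * h - (1 : ℕ)) = -(α * h) + 1 by push_cast; ring,
      Real.rpow_add_one (by norm_num)]
    ring
  -- Unitaries on `E` cancel in the diagonal blocks, so `ρ_B` does not depend on `A` and `B`.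
  have hS : ∀ a : Bits (Fin 1), (actE h (if a 0 = 0 then A else B) * encodingMap Ψ)ᴴ *
      (actE h (if a 0 = 0 then A else B) * encodingMap Ψ) =
        (encodingMap Ψ)ᴴ * encodingMap Ψ := by
    intro a
    have : (actE h (if a 0 = 0 then A else B))ᴴ * actE h (if a 0 = 0 then A else B) = 1 := by
      split_ifs
      exacts [actE_conjTranspose_mul_self hA, actE_conjTranspose_mul_self hB]
    rw [Matrix.conjTranspose_mul, Matrix.mul_assoc, ← Matrix.mul_assoc _ _ (encodingMap Ψ), this,
      Matrix.one_mul]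
  have hF : traceFst (rhoOB Ψ U) k l = 1 / 2 * ((encodingMap Ψ)ᴴ * encodingMap Ψ) l k := by
    simp only [traceFst, hρ, hS]
    simp
    ring
  have hT : traceSnd (rhoOB Ψ U) (fun _ => 1) 0 =
      1 / 4 * ((actE h A * encodingMap Ψ)ᴴ * (actE h B * encodingMap Ψ)).trace := by
    simp only [traceSnd, hρ, Matrix.trace, Finset.mul_sum]
    rfl
  rw [hrhs, Matrix.sub_apply, Matrix.kronecker_apply, hF, hT, hρ] at h1
  simp only [Pi.zero_apply, if_true, one_ne_zero, if_false] at h1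
  generalize ((actE h A * encodingMap Ψ)ᴴ * (actE h B * encodingMap Ψ)) = R at h1 ⊢
  generalize ((encodingMap Ψ)ᴴ * encodingMap Ψ) l k = S at h1 ⊢
  have e : R l k - R.trace / 2 * S = 4 * (1 / 4 * R l k - 1 / 4 * R.trace * (1 / 2 * S)) := by ring
  rw [e, norm_mul]
  have : ‖(4 : ℂ)‖ = 4 := by simp
  rw [this]
  linarith

end Decoupling

/-! ### Gram matrix of the code images, error estimate and conclusion -/

section LogicalOperators

theorem norm_sandwich_sub_le {m n : Type} [Fintype m] [DecidableEq m] [Fintype n] [DecidableEq n]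
    {K : Matrix m m ℂ} {V V' : Matrix m n ℂ} {η : ℝ} (hK : ‖K‖ ≤ 1) (hV : ‖V‖ ≤ 1)
    (hVV : ‖V - V'‖ ≤ 2 * η) (hη : η ≤ 1) :
    ‖Vᴴ * K * V - V'ᴴ * K * V'‖ ≤ 8 * η := by
  have hη0 : 0 ≤ η := by linarith [norm_nonneg (V - V')]
  have hV' : ‖V'‖ ≤ 3 := by
    have := norm_sub_le V (V - V')
    rw [sub_sub_cancel] at this
    linarith
  have e : Vᴴ * K * V - V'ᴴ * K * V' = (V - V')ᴴ * (K * V) + V'ᴴ * (K * (V - V')) := by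
    simp only [Matrix.conjTranspose_sub, Matrix.sub_mul, Matrix.mul_sub, Matrix.mul_assoc]
    abel
  have h1 : ‖(V - V')ᴴ * (K * V)‖ ≤ 2 * η * (1 * 1) := by
    refine (Matrix.l2_opNorm_mul _ _).trans ?_
    rw [Matrix.l2_opNorm_conjTranspose]
    gcongr
    exact (Matrix.l2_opNorm_mul _ _).trans (by gcongr)
  have h2 : ‖V'ᴴ * (K * (V - V'))‖ ≤ 3 * (1 * (2 * η)) := by
    refine (Matrix.l2_opNorm_mul _ _).trans ?_
    rw [Matrix.l2_opNorm_conjTranspose]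
    gcongr
    exact (Matrix.l2_opNorm_mul _ _).trans (by gcongr)
  rw [e]
  exact (norm_add_le _ _).trans (by linarith)

/-- The blocks of the Gram matrix of the code space and its images under low-complexity unitaries
on the radiation are almost proportional to the identity. -/
theorem norm_gram_block_sub_le {e h : ℕ} {α : ℝ} (hα : 0 < α) {s : ℕ} {Ψ : StateEHB e h}
    (hd : DecoupledUpTo α (14 * s + 1) Ψ)
    {V : Matrix (Bits (Fin e) × Bits (Fin h)) (Fin 2) ℂ} (hV : IsCodeEmbedding α Ψ V)
    {A B : Matrix (Bits (Fin e)) (Bits (Fin e)) ℂ}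
    (hA : A ∈ Matrix.unitaryGroup (Bits (Fin e)) ℂ) (hB : B ∈ Matrix.unitaryGroup (Bits (Fin e)) ℂ)
    (hAc : ComplexityLE s A) (hBc : ComplexityLE s B) (l k : Fin 2) :
    ‖((actE h A * V)ᴴ * (actE h B * V)) l k -
      ((actE h A * V)ᴴ * (actE h B * V)).trace / 2 * (1 : Matrix (Fin 2) (Fin 2) ℂ) l k‖ ≤
        200 * (2 : ℝ) ^ (-(α * h)) := by
  have hb := decoupled_block hd hA hB hAc hBc l k
  have hη0 : (0 : ℝ) ≤ (2 : ℝ) ^ (-(α * h)) := by positivity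
  have hη1 : (2 : ℝ) ^ (-(α * h)) ≤ 1 :=
    Real.rpow_le_one_of_one_le_of_nonpos one_le_two (by
      have : 0 ≤ α * h := by positivity
      linarith)
  obtain ⟨hV1, hV2⟩ := hV
  have hVn := norm_le_one_of_isometry hV1
  have e : ∀ X : Matrix (Bits (Fin e) × Bits (Fin h)) (Fin 2) ℂ,
      (actE h A * X)ᴴ * (actE h B * X) = Xᴴ * ((actE h A)ᴴ * actE h B) * X := fun X => by
    rw [Matrix.conjTranspose_mul]
    simp only [Matrix.mul_assoc]
  rw [e] at hb ⊢
  generalize (2 : ℝ) ^ (-(α * h)) = η at *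
  generalize encodingMap Ψ = V' at *
  have hK : ‖(actE h A)ᴴ * actE h B‖ ≤ 1 := by
    refine (Matrix.l2_opNorm_mul _ _).trans ?_
    rw [Matrix.l2_opNorm_conjTranspose]
    exact mul_le_one₀ (norm_le_one_of_isometry (actE_conjTranspose_mul_self hA)) (norm_nonneg _)
      (norm_le_one_of_isometry (actE_conjTranspose_mul_self hB))
  have hR := norm_sandwich_sub_le hK hVn hV2 hη1
  have hS := norm_sandwich_sub_le (K := 1)
    (norm_le_one_of_isometry (by rw [Matrix.conjTranspose_one, one_mul])) hVn hV2 hη1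
  rw [Matrix.mul_one, Matrix.mul_one, hV1] at hS
  have hRn : ‖Vᴴ * ((actE h A)ᴴ * actE h B) * V‖ ≤ 1 := by
    refine (Matrix.l2_opNorm_mul _ _).trans (mul_le_one₀ ?_ (norm_nonneg _) hVn)
    refine (Matrix.l2_opNorm_mul _ _).trans (mul_le_one₀ ?_ (norm_nonneg _) hK)
    rwa [Matrix.l2_opNorm_conjTranspose]
  generalize Vᴴ * ((actE h A)ᴴ * actE h B) * V = R at *
  generalize V'ᴴ * ((actE h A)ᴴ * actE h B) * V' = R' at *
  generalize V'ᴴ * V' = S at *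
  have htr : ∀ M : Matrix (Fin 2) (Fin 2) ℂ, ‖M.trace / 2‖ ≤ ‖M‖ := by
    intro M
    have h0 := norm_entry_le M 0 0
    have h1 := norm_entry_le M 1 1
    have h2 := norm_add_le (M 0 0) (M 1 1)
    rw [Matrix.trace_fin_two, norm_div]
    have : ‖(2 : ℂ)‖ = 2 := by simp
    rw [this]
    linarith
  -- Passing from `V'` to `V` in `R` and in `S` costs `8 η + 48 η + 72 η + 8 η = 136 η`, within the
  -- bound `200 η`.
  have hdec : R l k - R.trace / 2 * (1 : Matrix (Fin 2) (Fin 2) ℂ) l k =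
      (R - R') l k + (R' l k - R'.trace / 2 * S l k) - (R - R').trace / 2 * S l k -
        R.trace / 2 * (1 - S) l k := by
    rw [Matrix.trace_sub, Matrix.sub_apply, Matrix.sub_apply]
    ring
  have hSn : ‖S‖ ≤ 9 := by
    have h1 := norm_sub_le (1 : Matrix (Fin 2) (Fin 2) ℂ) (1 - S)
    have h2 : ‖(1 : Matrix (Fin 2) (Fin 2) ℂ)‖ ≤ 1 :=
      norm_le_one_of_isometry (by rw [Matrix.conjTranspose_one, one_mul])
    rw [sub_sub_cancel] at h1
    linarith
  have b1 := (norm_entry_le (R - R') l k).trans hR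
  have b2 : ‖(R - R').trace / 2 * S l k‖ ≤ 8 * η * 9 := by
    rw [norm_mul]
    exact mul_le_mul ((htr _).trans hR) ((norm_entry_le S l k).trans hSn) (norm_nonneg _)
      (by positivity)
  have b3 : ‖R.trace / 2 * (1 - S) l k‖ ≤ 1 * (8 * η) := by
    rw [norm_mul]
    exact mul_le_mul ((htr _).trans hRn) ((norm_entry_le (1 - S) l k).trans hS) (norm_nonneg _)
      zero_le_one
  rw [hdec]
  refine (norm_sub_le _ _).trans ?_
  have c1 := norm_sub_le ((R - R') l k + (R' l k - R'.trace / 2 * S l k))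
    ((R - R').trace / 2 * S l k)
  have c2 := norm_add_le ((R - R') l k) (R' l k - R'.trace / 2 * S l k)
  linarith

theorem complexityLE_one {Q : Type} [Fintype Q] [DecidableEq Q] (s : ℕ) :
    ComplexityLE s (1 : Matrix (Bits Q) (Bits Q) ℂ) := by
  refine ⟨0, 1, ⟨[], by simp, by simp, by simp⟩, fun x y z => ?_⟩
  rw [Subsingleton.elim z 0, if_pos rfl, Matrix.one_apply, Matrix.one_apply]
  refine if_congr ⟨fun h => ?_, fun h => by rw [h]⟩ rfl rfl
  funext k
  exact congrFun h (Sum.inl k)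

theorem norm_submatrix_le {l m n : Type} [Fintype l] [DecidableEq l] [Fintype m] [DecidableEq m]
    [Fintype n] [DecidableEq n] (M : Matrix l m ℂ) {f : n → m} (hf : Function.Injective f) :
    ‖M.submatrix id f‖ ≤ ‖M‖ := by
  have h1 : M.submatrix id f = M * (1 : Matrix m m ℂ).submatrix id f := by
    ext i j
    simp [Matrix.mul_apply, Matrix.one_apply]
  have h2 : ((1 : Matrix m m ℂ).submatrix id f)ᴴ * (1 : Matrix m m ℂ).submatrix id f = 1 := by
    ext i j
    simp [Matrix.mul_apply, Matrix.one_apply, hf.eq_iff]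
  rw [h1]
  refine (Matrix.l2_opNorm_mul _ _).trans ?_
  exact mul_le_of_le_one_right (norm_nonneg _) (norm_le_one_of_isometry h2)

/-- If the blocks of the Gram matrix of a family of maps `X a` are almost proportional to the
identity, then each operator on their common domain is almost implemented, on all the images, by
a single operator. -/
theorem exists_common_logical {l J : Type} [Fintype l] [DecidableEq l] [Fintype J] [DecidableEq J]
    (X : J → Matrix l (Fin 2) ℂ) {r : ℝ}
    (hX : ∀ a b i j, ‖((X a)ᴴ * X b) i j -
      ((X a)ᴴ * X b).trace / 2 * (1 : Matrix (Fin 2) (Fin 2) ℂ) i j‖ ≤ r)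
    (T : Matrix (Fin 2) (Fin 2) ℂ) :
    ∃ L : Matrix l l ℂ, ∀ a, ‖L * X a - X a * T‖ ≤
      2 * Real.sqrt (4 * (Fintype.card J : ℝ) ^ 2 * r) * ‖T‖ := by
  -- `W` is the row of the blocks `X a`, while `Y` has the vectorized `X a` as columns. Thus `Yᴴ * Y
  -- / 2` has the entries `Tr ((X a)ᴴ X b) / 2` and is manifestly positive, as `exists_logical`
  -- demands of `g`.
  let W : Matrix l (J × Fin 2) ℂ := Matrix.of fun x c => X c.1 x c.2
  let Y : Matrix (l × Fin 2) J ℂ := Matrix.of fun x a => X a x.1 x.2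
  have hg : 0 ≤ (1 / 2 : ℝ) • (Yᴴ * Y) :=
    smul_nonneg (by norm_num) (conjTranspose_mul_self_nonneg Y)
  obtain ⟨L, hL⟩ := exists_logical W _ hg T
  refine ⟨L, fun a => ?_⟩
  have hga : ∀ a b, ((1 / 2 : ℝ) • (Yᴴ * Y)) a b = ((X a)ᴴ * X b).trace / 2 := by
    intro a b
    rw [Matrix.smul_apply, Matrix.mul_apply, Fintype.sum_prod_type, Finset.sum_comm]
    simp only [Matrix.trace, Matrix.diag, Matrix.mul_apply, Matrix.conjTranspose_apply, Y,
      Matrix.of_apply]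
    rw [Complex.real_smul]
    push_cast
    ring
  have hn : ‖Wᴴ * W - ((1 / 2 : ℝ) • (Yᴴ * Y)) ⊗ₖ (1 : Matrix (Fin 2) (Fin 2) ℂ)‖ ≤
      4 * (Fintype.card J : ℝ) ^ 2 * r := by
    refine (norm_le_of_entry_le _ (r := r) ?_).trans (le_of_eq ?_)
    · rintro ⟨a, i⟩ ⟨b, j⟩
      rw [Matrix.sub_apply, Matrix.kronecker_apply, hga]
      exact hX a b i j
    · rw [Fintype.card_prod, Fintype.card_fin]
      push_cast
      ring
  have hsub : L * X a - X a * T =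
      (L * W - W * ((1 : Matrix J J ℂ) ⊗ₖ T)).submatrix id fun k => (a, k) := by
    ext x k
    rw [Matrix.submatrix_apply, Matrix.sub_apply, Matrix.sub_apply]
    congr 1
    rw [Matrix.mul_apply, Matrix.mul_apply, Fintype.sum_prod_type, Finset.sum_eq_single a]
    · simp [W]
    · intro b _ hb
      simp [Matrix.one_apply_ne hb]
    · simp
  rw [hsub]
  refine (norm_submatrix_le _ fun i j hij => (Prod.mk.inj hij).2).trans (hL.trans ?_)
  gcongr

/-- An operator that implements `T` on the images of `V` and of `A * V`, up to an error `δ * t`,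
commutes with `A` on the image of `V`, up to an error `2 * δ * t`. -/
theorem norm_commutator_mul_le {m n : Type} [Fintype m] [DecidableEq m] [Fintype n]
    [DecidableEq n] {A L : Matrix m m ℂ} {V : Matrix m n ℂ} {T : Matrix n n ℂ} {δ t : ℝ}
    (hA : ‖A‖ ≤ 1) (h : ‖L * (A * V) - A * V * T‖ ≤ δ * t) (h' : ‖L * V - V * T‖ ≤ δ * t) :
    ‖(A * L - L * A) * V‖ ≤ 2 * δ * t := by
  have hsplit : (A * L - L * A) * V = A * (L * V - V * T) - (L * (A * V) - A * V * T) := by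
    simp only [Matrix.sub_mul, Matrix.mul_sub, Matrix.mul_assoc]
    abel
  have h1 : ‖A * (L * V - V * T)‖ ≤ 1 * (δ * t) :=
    (Matrix.l2_opNorm_mul _ _).trans (mul_le_mul hA h' (norm_nonneg _) zero_le_one)
  rw [hsplit]
  refine (norm_sub_le _ _).trans ?_
  linarith

theorem tendsto_polynomial_mul_pow (p : Polynomial ℕ) {r : ℝ} (h0 : 0 ≤ r) (h1 : r < 1) :
    Filter.Tendsto (fun n : ℕ => ((p.eval n : ℕ) : ℝ) * r ^ n) Filter.atTop (nhds 0) := by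
  have : ∀ n : ℕ, ((p.eval n : ℕ) : ℝ) * r ^ n =
      ∑ i ∈ Finset.range (p.natDegree + 1), (p.coeff i : ℝ) * ((n : ℝ) ^ i * r ^ n) := by
    intro n
    rw [Polynomial.eval_eq_sum_range, Nat.cast_sum, Finset.sum_mul]
    refine Finset.sum_congr rfl fun i _ => ?_
    push_cast
    ring
  simp only [this]
  rw [← Finset.sum_const_zero (s := Finset.range (p.natDegree + 1))]
  refine tendsto_finsetSum _ fun i _ => ?_
  rw [← mul_zero (p.coeff i : ℝ)]
  exact (tendsto_pow_const_mul_const_pow_of_lt_one i h0 h1).const_mul _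

theorem eventually_polynomial_mul_rpow_le {α : ℝ} (hα : 0 < α) (p : Polynomial ℕ) {c : ℝ}
    (hc : 0 < c) : ∃ h₀ : ℕ, ∀ h, h₀ ≤ h → ((p.eval h : ℕ) : ℝ) * (2 : ℝ) ^ (-(α * h)) ≤ c := by
  have h1 : (2 : ℝ) ^ (-α) < 1 := Real.rpow_lt_one_of_one_lt_of_neg one_lt_two (by linarith)
  have := (tendsto_polynomial_mul_pow p (by positivity) h1).eventually_le_const hc
  obtain ⟨h₀, hh⟩ := Filter.eventually_atTop.1 this
  refine ⟨h₀, fun h hle => ?_⟩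
  have := hh h hle
  rwa [← Real.rpow_natCast, ← Real.rpow_mul zero_le_two, neg_mul] at this

/-- In terms of `u = η^{1/4}` and `v = (N+1)^{1/4}` the claim follows from `√800 u² v⁴ ≤ 4 u v³`,
that is, `(u v)² ≤ 1/50`; this is where `1/2500` comes from. The factor `6^{1/4}` is only used as at
least 1. -/
theorem two_mul_sqrt_le_deltaPrime {α : ℝ} {h N : ℕ}
    (hN : ((N : ℝ) + 1) * (2 : ℝ) ^ (-(α * h)) ≤ 1 / 2500) :
    2 * Real.sqrt (4 * ((N : ℝ) + 1) ^ 2 * (200 * (2 : ℝ) ^ (-(α * h)))) ≤ deltaPrime α h N := by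
  have hn : (0 : ℝ) < (N : ℝ) + 1 := by positivity
  obtain ⟨u, hu⟩ : ∃ u, u = (2 : ℝ) ^ (-(α * h) / 4) := ⟨_, rfl⟩
  obtain ⟨v, hv⟩ : ∃ v, v = ((N : ℝ) + 1) ^ (1 / 4 : ℝ) := ⟨_, rfl⟩
  have hu0 : 0 < u := by rw [hu]; positivity
  have hv0 : 0 < v := by rw [hv]; positivity
  have hu4 : (2 : ℝ) ^ (-(α * h)) = u ^ 4 := by
    rw [hu, ← Real.rpow_natCast, ← Real.rpow_mul zero_le_two]
    congr 1
    push_cast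
    ring
  have hv4 : (N : ℝ) + 1 = v ^ 4 := by
    rw [hv, ← Real.rpow_natCast, ← Real.rpow_mul hn.le]
    norm_num
  have hv3 : ((N : ℝ) + 1) ^ (3 / 4 : ℝ) = v ^ 3 := by
    rw [hv, ← Real.rpow_natCast, ← Real.rpow_mul hn.le]
    norm_num
  have h6 : (1 : ℝ) ≤ (6 : ℝ) ^ (1 / 4 : ℝ) := Real.one_le_rpow (by norm_num) (by norm_num)
  have huv : (u * v) ^ 2 ≤ 1 / 50 := by
    rw [hu4, hv4] at hN
    refine abs_le_of_sq_le_sq' ?_ (by norm_num) |>.2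
    calc ((u * v) ^ 2) ^ 2 = v ^ 4 * u ^ 4 := by ring
      _ ≤ 1 / 2500 := hN
      _ = (1 / 50) ^ 2 := by norm_num
  have hδ : 8 * u * v ^ 3 ≤ deltaPrime α h N := by
    rw [deltaPrime, ← hu, hv3]
    have : 0 ≤ u * v ^ 3 := by positivity
    nlinarith
  refine le_trans ?_ hδ
  have hs : Real.sqrt (4 * ((N : ℝ) + 1) ^ 2 * (200 * (2 : ℝ) ^ (-(α * h)))) ≤ 4 * u * v ^ 3 := by
    refine Real.sqrt_le_iff.2 ⟨by positivity, ?_⟩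
    rw [hu4, hv4]
    have : 0 ≤ u ^ 2 * v ^ 6 := by positivity
    nlinarith
  linarith

/-- Logical operators that almost commute with given low-complexity unitaries on the radiation, for
a single black hole. -/
theorem exists_logical_operator {e h : ℕ} {α : ℝ} (hα : 0 < α) {s : ℕ} {Ψ : StateEHB e h}
    (hd : DecoupledUpTo α (14 * s + 1) Ψ)
    {V : Matrix (Bits (Fin e) × Bits (Fin h)) (Fin 2) ℂ} (hV : IsCodeEmbedding α Ψ V) {N : ℕ}
    (hN : ((N : ℝ) + 1) * (2 : ℝ) ^ (-(α * h)) ≤ 1 / 2500)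
    (U : Fin N → Matrix.unitaryGroup (Bits (Fin e)) ℂ)
    (hU : ∀ a, ComplexityLE s (U a : Matrix (Bits (Fin e)) (Bits (Fin e)) ℂ))
    (T : Matrix (Fin 2) (Fin 2) ℂ) :
    ∃ L : Matrix (Bits (Fin e) × Bits (Fin h)) (Bits (Fin e) × Bits (Fin h)) ℂ,
      (∀ a, ‖(actE h (U a).1 * L - L * actE h (U a).1) * V‖ ≤ 2 * deltaPrime α h N * ‖T‖) ∧
      ‖L * V - V * T‖ ≤ deltaPrime α h N * ‖T‖ := by
  -- The identity joins the family as the index `none`, whence `N + 1`; it yields the second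
  -- inequality, even for `N = 0`.
  obtain ⟨U', hU₀, hU₁⟩ : ∃ U' : Option (Fin N) → Matrix.unitaryGroup (Bits (Fin e)) ℂ,
      U' none = 1 ∧ ∀ a, U' (some a) = U a := ⟨fun a => a.elim 1 U, rfl, fun _ => rfl⟩
  have hU' : ∀ a, ComplexityLE s (U' a : Matrix (Bits (Fin e)) (Bits (Fin e)) ℂ) := by
    rintro (_ | a)
    · rw [hU₀]
      exact complexityLE_one s
    · rw [hU₁]
      exact hU a
  obtain ⟨X, hXdef⟩ : ∃ X : Option (Fin N) → Matrix (Bits (Fin e) × Bits (Fin h)) (Fin 2) ℂ,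
      ∀ a, X a = actE h (U' a).1 * V := ⟨_, fun _ => rfl⟩
  have hX : ∀ a b l k, ‖((X a)ᴴ * X b) l k -
      ((X a)ᴴ * X b).trace / 2 * (1 : Matrix (Fin 2) (Fin 2) ℂ) l k‖ ≤
        200 * (2 : ℝ) ^ (-(α * h)) := by
    intro a b
    rw [hXdef, hXdef]
    exact norm_gram_block_sub_le hα hd hV (U' a).2 (U' b).2 (hU' a) (hU' b)
  obtain ⟨L, hL⟩ := exists_common_logical X hX T
  have hL' : ∀ a, ‖L * X a - X a * T‖ ≤ deltaPrime α h N * ‖T‖ := by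
    intro a
    refine (hL a).trans (mul_le_mul_of_nonneg_right ?_ (norm_nonneg T))
    rw [Fintype.card_option, Fintype.card_fin, Nat.cast_add, Nat.cast_one]
    exact two_mul_sqrt_le_deltaPrime hN
  have h0 : ‖L * V - V * T‖ ≤ deltaPrime α h N * ‖T‖ := by
    have := hL' none
    rwa [hXdef, hU₀, Matrix.UnitaryGroup.one_val, actE_one, Matrix.one_mul] at this
  refine ⟨L, fun a => ?_, h0⟩
  have ha := hL' (some a)
  rw [hXdef, hU₁] at ha
  exact norm_commutator_mul_le (norm_le_one_of_isometry (actE_conjTranspose_mul_self (U a).2)) ha h0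

end LogicalOperators

end BlackHole

theorem theorem8p10 {ι : Type*} (α : ℝ) (hα : 0 < α) (e h : ι → ℕ)
    (Ψ : ∀ i, StateEHB (e i) (h i)) (hΨ : ∀ i, ‖Ψ i‖ = 1)
    (hdec : DecouplingBound α e h Ψ) :
    ∀ p q : Polynomial ℕ, ∃ h₀ : ℕ, ∀ i, h₀ ≤ h i →
      ∀ V : Matrix (Bits (Fin (e i)) × Bits (Fin (h i))) (Fin 2) ℂ,
        IsCodeEmbedding α (Ψ i) V →
      ∀ (N : ℕ) (U : Fin N → Matrix.unitaryGroup (Bits (Fin (e i))) ℂ),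
        N ≤ p.eval (h i) →
        (∀ a, ComplexityLE (q.eval (h i)) (U a : Matrix (Bits (Fin (e i))) (Bits (Fin (e i))) ℂ)) →
        ∃ L : {T' : Matrix (Fin 2) (Fin 2) ℂ // IsStarNormal T'} →
            Matrix (Bits (Fin (e i)) × Bits (Fin (h i)))
              (Bits (Fin (e i)) × Bits (Fin (h i))) ℂ,
          ∀ T',
            (∀ a, ‖(actE (h i) (U a) * L T' - L T' * actE (h i) (U a)) * V‖ ≤
              2 * deltaPrime α (h i) N * ‖T'.1‖) ∧
            ‖L T' * V - V * T'.1‖ ≤ deltaPrime α (h i) N * ‖T'.1‖ := by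
  intro p q
  -- `14 q + 1` is the size of the interferometer built from circuits of size `q`.
  obtain ⟨h₁, hh₁⟩ := hdec (Polynomial.C 14 * q + 1)
  obtain ⟨h₂, hh₂⟩ := eventually_polynomial_mul_rpow_le hα (p + 1) (c := 1 / 2500) (by norm_num)
  refine ⟨max h₁ h₂, fun i hi V hV N U hN hU => ?_⟩
  have hd := hh₁ i ((le_max_left _ _).trans hi)
  have hs := hh₂ (h i) ((le_max_right _ _).trans hi)
  rw [Polynomial.eval_add, Polynomial.eval_one, Polynomial.eval_mul, Polynomial.eval_C] at hd
  have hN' : ((N : ℝ) + 1) * (2 : ℝ) ^ (-(α * h i)) ≤ 1 / 2500 := by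
    refine le_trans ?_ hs
    have : (N : ℝ) ≤ ((p.eval (h i) : ℕ) : ℝ) := by exact_mod_cast hN
    rw [Polynomial.eval_add, Polynomial.eval_one]
    push_cast
    gcongr
  choose L hL using exists_logical_operator hα hd hV hN' U hU
  exact ⟨fun T => L T.1, fun T => hL T.1⟩
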